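/- Let $M$ be an oriented matroid on a finite linearly ordered set $E$. Let $t(M;x,y)=\sum_{A\subseteq E}(x-1)^{r(E)-r(A)}(y-1)^{|A|-r(A)}=\sum_{a,b}t_{a,b}\,x^a y^b$ be the Tutte polynomial of its underlying matroid. For $A\subseteq E$ let $-_AM$ be the reorientation of $M$ on $A$. Reorientations are identified with the subsets $A$, so there are $2^{|E|}$ of them. For an oriented matroid $N$ on $E$, the set $O(N)$ of active elements, respectively $O^*(N)$ of dual-active elements, is the set of minima of the positive circuits, respectively positive cocircuits, of $N$. The activity of $N$ is $|O(N)|$ and its dual activity is $|O^*(N)|$. The active partition of $N$ consists of the following sets. For each $a\in O(N)$ it contains the union of the positive circuits with minimum $\ge a$ minus the union of those with minimum $>a$. For each $a\in O^*(N)$ it contains the union of the positive cocircuits with minimum $\ge a$ minus the union of those with minimum $>a$. The activity class of $-_AM$ is the set of all reorientations $-_{A\triangle U}M$, where $U$ is a union of parts of the active partition of $-_AM$. An activity class has activity $i$ and dual activity $j$ if all its members do. It is acyclic, or totally cyclic, if all its members are. Say that $-_AM$ is active-fixed if $O(-_AM)\cap A=\emptyset$, and dual-active-fixed if $O^*(-_AM)\cap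 A=\emptyset$. 1. For all $i,j\ge 0$, the number of activity classes of reorientations of $M$ with activity $i$ and dual activity $j$ equals $t_{j,i}$, the coefficient of $x^jy^i$ in $t(M;x,y)$. 2. Each activity class contains exactly one reorientation that is both active-fixed and dual-active-fixed. For all $i,j\ge 0$, the number of such reorientations of $M$ with activity $i$ and dual activity $j$ equals $t_{j,i}$. 3. Each activity class with activity $i$ and dual activity $j$ contains exactly $2^j$ active-fixed reorientations and exactly $2^i$ dual-active-fixed reorientations. 4. The following enumerations hold. - The number of active-fixed and dual-active-fixed reorientations, and the number of all activity classes, both equal $t(M;1,1)$. - The number of acyclic and dual-active-fixed reorientations, and the number of acyclic activity classes, both equal $t(M;1,0)$. Each acyclic activity class contains exactly one dual-active-fixed reorientation. - The number of active-fixed and totally cyclic reorientations, and the number of totally cyclic activity classes, both equal $t(M;0,1)$. Each totally cyclic activity class contains exactly one active-fixed reorientation. - The number of active-fixed reorientations equals $t(M;2,1)$. - The number of dual-active-fixed reorientations equals $t(M;1,2)$. -/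

import Mathlib

/-- An oriented matroid on the finite set `E`, given by its signed circuits.  A signed subset `X`
is coded by its sign function (`X e = 1` on `X⁺`, `X e = -1` on `X⁻`, `X e = 0` off the support). -/
structure OrientedMatroid (α : Type*) where
  E : Finset α
  circuits : Set (α → SignType)
  support_subset : ∀ X ∈ circuits, Function.support X ⊆ (E : Set α)
  zero_notMem : (0 : α → SignType) ∉ circuits
  neg_mem : ∀ X ∈ circuits, -X ∈ circuits
  incomparable : ∀ X ∈ circuits, ∀ Y ∈ circuits,
    Function.support X ⊆ Function.support Y → X = Y ∨ X = -Y
  elimination : ∀ X ∈ circuits, ∀ Y ∈ circuits, X ≠ -Y → ∀ e, X e = 1 → Y e = -1 →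
    ∃ Z ∈ circuits, Z e = 0 ∧ ∀ f,
      (Z f = 1 → X f = 1 ∨ Y f = 1) ∧ (Z f = -1 → X f = -1 ∨ Y f = -1)

namespace OrientedMatroid

variable {α : Type*}

/-- Unsigned circuit elimination, for the supports of the signed circuits. -/
theorem support_elimination (M : OrientedMatroid α) {X Y : α → SignType} (hX : X ∈ M.circuits)
    (hY : Y ∈ M.circuits) (hXY : Function.support X ≠ Function.support Y) {e : α}
    (hXe : X e ≠ 0) (hYe : Y e ≠ 0) :
    ∃ Z ∈ M.circuits, Function.support Z ⊆
      (Function.support X ∪ Function.support Y) \ {e} := by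
  have key : ∀ X' ∈ M.circuits, ∀ Y' ∈ M.circuits, X' e = 1 → Y' e = -1 →
      Function.support X' = Function.support X → Function.support Y' = Function.support Y →
      ∃ Z ∈ M.circuits, Function.support Z ⊆
        (Function.support X ∪ Function.support Y) \ {e} := by
    intro X' hX' Y' hY' h1 h2 hs ht
    have hne : X' ≠ -Y' := by
      rintro rfl
      apply hXY
      rw [← hs, ← ht]
      ext f
      simp
    obtain ⟨Z, hZ, hZe, hZf⟩ := M.elimination X' hX' Y' hY' hne e h1 h2
    refine ⟨Z, hZ, fun f hf => ⟨?_, ?_⟩⟩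
    · rw [← hs, ← ht]
      simp only [Set.mem_union, Function.mem_support] at hf ⊢
      obtain ⟨hp, hn⟩ := hZf f
      rcases hz : Z f with _ | _ | _
      · exact absurd hz hf
      · rcases hn hz with h | h
        · left; rw [h]; decide
        · right; rw [h]; decide
      · rcases hp hz with h | h
        · left; rw [h]; decide
        · right; rw [h]; decide
    · rintro rfl
      exact hf hZe
  have hnegs : ∀ W : α → SignType, Function.support (-W) = Function.support W := by
    intro W; ext f; simp
  have cases3 : ∀ s : SignType, s ≠ 0 → s = 1 ∨ s = -1 := by decide
  rcases cases3 _ hXe with hx | hx <;> rcases cases3 _ hYe with hy | hy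
  · exact key X hX (-Y) (M.neg_mem Y hY) hx (by simp [hy]) rfl (hnegs Y)
  · exact key X hX Y hY hx hy rfl rfl
  · exact key (-X) (M.neg_mem X hX) (-Y) (M.neg_mem Y hY) (by simp [hx]) (by simp [hy])
      (hnegs X) (hnegs Y)
  · exact key (-X) (M.neg_mem X hX) Y hY (by simp [hx]) hy (hnegs X) rfl

/-- Independence in the underlying matroid: no circuit is contained in `I`. -/
def IndepSet (M : OrientedMatroid α) (I : Set α) : Prop :=
  I ⊆ (M.E : Set α) ∧ ∀ X ∈ M.circuits, ¬ Function.support X ⊆ I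

theorem IndepSet.subset {M : OrientedMatroid α} {I J : Set α} (hJ : M.IndepSet J) (h : I ⊆ J) :
    M.IndepSet I :=
  ⟨h.trans hJ.1, fun X hX hs => hJ.2 X hX (hs.trans h)⟩

theorem IndepSet.augment {M : OrientedMatroid α} {I J : Set α} (hI : M.IndepSet I)
    (hJ : M.IndepSet J) (hIJ : I.ncard < J.ncard) :
    ∃ e ∈ J, e ∉ I ∧ M.IndepSet (insert e I) := by
  by_contra hcon
  push Not at hcon
  have fin : ∀ {K : Set α}, M.IndepSet K → K.Finite := fun hK =>
    M.E.finite_toSet.subset hK.1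
  have hex : ∃ n, ∃ K : Set α, M.IndepSet K ∧ K ⊆ I ∪ J ∧ I.ncard < K.ncard ∧
      (I \ K).ncard = n := ⟨_, J, hJ, Set.subset_union_right, hIJ, rfl⟩
  classical
  obtain ⟨K, hK, hKs, hKc, hKn⟩ := Nat.find_spec hex
  have hmin : ∀ L : Set α, M.IndepSet L → L ⊆ I ∪ J → I.ncard < L.ncard →
      (I \ K).ncard ≤ (I \ L).ncard := by
    intro L h1 h2 h3
    rw [hKn]
    exact Nat.find_min' hex ⟨L, h1, h2, h3, rfl⟩
  obtain ⟨g, hgK, hgI⟩ : ∃ g ∈ K, g ∉ I := by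
    by_contra h
    push Not at h
    exact absurd (Set.ncard_le_ncard h (fin hI)) (not_le.2 hKc)
  obtain ⟨e, heI, heK⟩ : ∃ e ∈ I, e ∉ K := by
    by_contra h
    push Not at h
    have hgJ : g ∈ J := (hKs hgK).resolve_left hgI
    exact hcon g hgJ hgI (hK.subset (Set.insert_subset hgK h))
  have hstep : ∀ f ∈ K, f ∉ I → ∃ X ∈ M.circuits,
      Function.support X ⊆ insert e (K \ {f}) ∧ X e ≠ 0 := by
    intro f hfK hfI
    have hsub : insert e (K \ {f}) ⊆ I ∪ J :=
      Set.insert_subset (Or.inl heI) (Set.sdiff_subset.trans hKs)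
    have hcard : (insert e (K \ {f})).ncard = K.ncard := by
      rw [Set.ncard_insert_of_notMem (fun h => heK h.1) ((fin hK).subset Set.sdiff_subset)]
      exact Set.ncard_sdiff_singleton_add_one hfK (fin hK)
    have hdep : ¬ M.IndepSet (insert e (K \ {f})) := by
      intro hind
      have h1 := hmin _ hind hsub (hcard ▸ hKc)
      refine absurd h1 (not_le.2 (Set.ncard_lt_ncard ?_ ((fin hI).subset Set.sdiff_subset)))
      refine ⟨fun x hx => ⟨hx.1, fun hxK => hx.2 (Or.inr ⟨hxK, ?_⟩)⟩, fun h => ?_⟩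
      · rintro rfl
        exact hfI hx.1
      · exact (h ⟨heI, heK⟩).2 (Or.inl rfl)
    have hgr : insert e (K \ {f}) ⊆ (M.E : Set α) :=
      Set.insert_subset (hI.1 heI) (Set.sdiff_subset.trans hK.1)
    have : ∃ X ∈ M.circuits, Function.support X ⊆ insert e (K \ {f}) := by
      by_contra h
      push Not at h
      exact hdep ⟨hgr, h⟩
    obtain ⟨X, hX, hXs⟩ := this
    refine ⟨X, hX, hXs, fun hXe => hK.2 X hX fun x hx => ?_⟩
    rcases hXs hx with rfl | hx'
    · exact absurd hXe hx
    · exact hx'.1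
  obtain ⟨X, hX, hXs, hXe⟩ := hstep g hgK hgI
  obtain ⟨h, hhX, hhK, hhI⟩ : ∃ h, X h ≠ 0 ∧ h ∈ K ∧ h ∉ I := by
    by_contra hno
    push Not at hno
    refine hI.2 X hX fun x hx => ?_
    rcases hXs hx with rfl | hx'
    · exact heI
    · exact hno x hx hx'.1
  obtain ⟨Y, hY, hYs, hYe⟩ := hstep h hhK hhI
  have hne : Function.support X ≠ Function.support Y := by
    intro heq
    have : h ∈ Function.support Y := heq ▸ hhX
    rcases hYs this with rfl | h'
    · exact hhI heI
    · exact h'.2 rfl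
  obtain ⟨Z, hZ, hZs⟩ := M.support_elimination hX hY hne hXe hYe
  refine hK.2 Z hZ fun x hx => ?_
  obtain ⟨h1, h2⟩ := hZs hx
  rcases h1 with h1 | h1
  · rcases hXs h1 with rfl | h'
    · exact absurd rfl h2
    · exact h'.1
  · rcases hYs h1 with rfl | h'
    · exact absurd rfl h2
    · exact h'.1

/-- The underlying matroid of an oriented matroid: its circuits are the supports of the
signed circuits. -/
def toMatroid (M : OrientedMatroid α) : Matroid α :=
  (IndepMatroid.ofFinite (E := (M.E : Set α)) M.E.finite_toSet M.IndepSet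
    ⟨Set.empty_subset _, fun X hX hs => M.zero_notMem
      (by rwa [Function.support_eq_empty_iff.1 (Set.subset_empty_iff.1 hs)] at hX)⟩
    (fun _ _ hJ h => hJ.subset h)
    (fun _ _ hI hJ h => hI.augment hJ h)
    (fun _ hI => hI.1)).matroid

/-- The Tutte polynomial `t(M; x, y) = ∑_{A ⊆ E} (x - 1)^{r(E) - r(A)} (y - 1)^{|A| - r(A)}`
of the underlying matroid, with `x = X 0` and `y = X 1`. -/
noncomputable def tutte (M : OrientedMatroid α) : MvPolynomial (Fin 2) ℤ :=
  ∑ A ∈ M.E.powerset,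
    (MvPolynomial.X 0 - 1) ^ ((M.toMatroid.eRk (M.E : Set α)).toNat
      - (M.toMatroid.eRk (A : Set α)).toNat) *
    (MvPolynomial.X 1 - 1) ^ (A.card - (M.toMatroid.eRk (A : Set α)).toNat)

/-- The value `t(M; x, y)`. -/
noncomputable def tutteEval (M : OrientedMatroid α) (x y : ℤ) : ℤ :=
  MvPolynomial.eval ![x, y] M.tutte

/-- The coefficient `t_{i,j}` of `x^i y^j` in `t(M; x, y)`. -/
noncomputable def tutteCoeff (M : OrientedMatroid α) (i j : ℕ) : ℤ :=
  MvPolynomial.coeff (Finsupp.single 0 i + Finsupp.single 1 j) M.tutte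

/-- Orthogonality of signed sets: a common element of the supports where the signs agree exists
if and only if one where they are opposite exists. -/
def Orthogonal (X Y : α → SignType) : Prop :=
  (∃ e, X e * Y e = 1) ↔ (∃ e, X e * Y e = -1)

/-- The signed cocircuits: the signatures of the cocircuits of the underlying matroid that are
orthogonal to all signed circuits. -/
def cocircuits (M : OrientedMatroid α) : Set (α → SignType) :=
  {Y | M.toMatroid.IsCocircuit (Function.support Y) ∧ ∀ X ∈ M.circuits, Orthogonal X Y}

/-- The supports of the positive circuits (no element has a negative sign). -/
def posCircuits (M : OrientedMatroid α) : Set (Set α) :=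
  {C | ∃ X ∈ M.circuits, (∀ e, 0 ≤ X e) ∧ Function.support X = C}

/-- The supports of the positive cocircuits. -/
def posCocircuits (M : OrientedMatroid α) : Set (Set α) :=
  {D | ∃ Y ∈ M.cocircuits, (∀ e, 0 ≤ Y e) ∧ Function.support Y = D}

def Acyclic (M : OrientedMatroid α) : Prop :=
  M.posCircuits = ∅

def TotallyCyclic (M : OrientedMatroid α) : Prop :=
  ∀ e ∈ M.E, ∃ C ∈ M.posCircuits, e ∈ C

variable [LinearOrder α]

/-- Reversal of the signs of a signed set on `A`. -/
def flip (A : Finset α) (X : α → SignType) : α → SignType :=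
  fun e => if e ∈ A then -X e else X e

theorem flip_flip (A : Finset α) (X : α → SignType) : flip A (flip A X) = X := by
  funext e
  by_cases h : e ∈ A <;> simp [flip, h]

theorem flip_neg (A : Finset α) (X : α → SignType) : flip A (-X) = -flip A X := by
  funext e
  by_cases h : e ∈ A <;> simp [flip, h]

theorem support_flip (A : Finset α) (X : α → SignType) :
    Function.support (flip A X) = Function.support X := by
  ext e
  by_cases h : e ∈ A <;> simp [flip, h]

/-- The reorientation `-_A M`: signs are reversed on `A` in every signed circuit. -/
def reorient (M : OrientedMatroid α) (A : Finset α) : OrientedMatroid α where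
  E := M.E
  circuits := {X | flip A X ∈ M.circuits}
  support_subset X hX := support_flip A X ▸ M.support_subset _ hX
  zero_notMem h := M.zero_notMem (by
    have h0 : flip A (0 : α → SignType) = 0 := by
      funext e
      simp [flip]
    rwa [Set.mem_ofPred_eq, h0] at h)
  neg_mem X hX := by
    rw [Set.mem_ofPred_eq, flip_neg]
    exact M.neg_mem _ hX
  incomparable X hX Y hY h := by
    have inj : ∀ U V : α → SignType, flip A U = flip A V → U = V := fun U V h => by
      rw [← flip_flip A U, h, flip_flip]
    rcases M.incomparable _ hX _ hY (by rwa [support_flip, support_flip]) with h | h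
    · exact Or.inl (inj _ _ h)
    · exact Or.inr (inj _ _ (by rw [h, flip_neg]))
  elimination X hX Y hY hne e hXe hYe := by
    have hne' : flip A X ≠ -flip A Y := fun h => hne (by
      rw [← flip_flip A X, h, ← flip_neg, flip_flip])
    by_cases he : e ∈ A
    · obtain ⟨Z, hZ, hZe, hZf⟩ := M.elimination _ hY _ hX
        (fun h => hne' (by rw [h, neg_neg])) e (by simp [flip, he, hYe]) (by simp [flip, he, hXe])
      refine ⟨flip A Z, by rwa [Set.mem_ofPred_eq, flip_flip], by simp [flip, hZe], fun f => ?_⟩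
      have h := hZf f
      by_cases hf : f ∈ A <;> simp only [flip, hf, if_true, if_false] at h ⊢ <;>
        revert h <;> generalize X f = a <;> generalize Y f = b <;> generalize Z f = c <;>
        revert a b c <;> decide
    · obtain ⟨Z, hZ, hZe, hZf⟩ := M.elimination _ hX _ hY hne' e
        (by simp [flip, he, hXe]) (by simp [flip, he, hYe])
      refine ⟨flip A Z, by rwa [Set.mem_ofPred_eq, flip_flip], by simp [flip, hZe], fun f => ?_⟩
      have h := hZf f
      by_cases hf : f ∈ A <;> simp only [flip, hf, if_true, if_false] at h ⊢ <;>
        revert h <;> generalize X f = a <;> generalize Y f = b <;> generalize Z f = c <;>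
        revert a b c <;> decide

/-- The active elements: the minima of the positive circuits. -/
def activeElements (M : OrientedMatroid α) : Set α :=
  {a | ∃ C ∈ M.posCircuits, IsLeast C a}

/-- The dual-active elements: the minima of the positive cocircuits. -/
def dualActiveElements (M : OrientedMatroid α) : Set α :=
  {a | ∃ D ∈ M.posCocircuits, IsLeast D a}

noncomputable def activity (M : OrientedMatroid α) : ℕ := M.activeElements.ncard

noncomputable def dualActivity (M : OrientedMatroid α) : ℕ := M.dualActiveElements.ncard

/-- For an active element `a`: the part with minimum `a` of the active partition, i.e. the union of
the positive circuits with minimum at least `a`, minus the union of those with minimum greater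
than `a`. -/
def cyclicPart (M : OrientedMatroid α) (a : α) : Set α :=
  ⋃₀ {C | C ∈ M.posCircuits ∧ ∃ m, IsLeast C m ∧ a ≤ m} \
    ⋃₀ {C | C ∈ M.posCircuits ∧ ∃ m, IsLeast C m ∧ a < m}

/-- For a dual-active element `a`: the part with minimum `a` of the active partition. -/
def acyclicPart (M : OrientedMatroid α) (a : α) : Set α :=
  ⋃₀ {D | D ∈ M.posCocircuits ∧ ∃ m, IsLeast D m ∧ a ≤ m} \
    ⋃₀ {D | D ∈ M.posCocircuits ∧ ∃ m, IsLeast D m ∧ a < m}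

/-- The active partition of `M`, as a family of subsets of the ground set. -/
def activePartition (M : OrientedMatroid α) : Set (Set α) :=
  M.cyclicPart '' M.activeElements ∪ M.acyclicPart '' M.dualActiveElements

/-- The activity class of the reorientation `-_A M`: all reorientations obtained from it by
reorienting a union of parts of its active partition.  A reorientation `-_B M` of `M` is
identified with the set `B ⊆ E`. -/
def activityClass (M : OrientedMatroid α) (A : Finset α) : Set (Finset α) :=
  {B | ∃ P ⊆ (M.reorient A).activePartition, (B : Set α) = symmDiff (A : Set α) (⋃₀ P)}

/-- The set of all activity classes of reorientations of `M`. -/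
def activityClasses (M : OrientedMatroid α) : Set (Set (Finset α)) :=
  {K | ∃ A ⊆ M.E, K = M.activityClass A}

/-- All members of the class `K` have activity `i` and dual activity `j`. -/
def ClassHasActivities (M : OrientedMatroid α) (K : Set (Finset α)) (i j : ℕ) : Prop :=
  ∀ A ∈ K, (M.reorient A).activity = i ∧ (M.reorient A).dualActivity = j

/-- `-_A M` is active-fixed with respect to `M`: no active element of `-_A M` is in `A`. -/
def ActiveFixed (M : OrientedMatroid α) (A : Finset α) : Prop :=
  (M.reorient A).activeElements ∩ (A : Set α) = ∅

/-- `-_A M` is dual-active-fixed with respect to `M`. -/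
def DualActiveFixed (M : OrientedMatroid α) (A : Finset α) : Prop :=
  (M.reorient A).dualActiveElements ∩ (A : Set α) = ∅

end OrientedMatroid

/-!
Write `w` for the greatest element. Of two reorientations that differ exactly in `w`, one has the
activities of `M \ w` and the other those of `M / w`, unless `w` is a loop or a coloop; by
induction, the sum of `x ^ #(P \ A) * u ^ #(P ∩ A) * y ^ #(O \ A) * v ^ #(O ∩ A)` over all
reorientations `-_A M`, with active elements `O` and dual-active elements `P`, is
`t(M; x + u, y + v)`. The values `u = 0` and `v = 0` single out the dual-active-fixed and the
active-fixed reorientations. What drives the induction is that vectors and covectors are orthogonal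
and satisfy the 3-painting lemma.

Reorienting on the union of the positive circuits that avoid a given lower set does not change, for
any lower set `L`, the union of the positive circuits that avoid `L`, and likewise for cocircuits.
So all members of an activity class have the same active partition, and a member `B` is determined
by its trace on the set of the minima of the parts, which can be any subset. Being active-fixed or
dual-active-fixed is a condition on this trace, whence the counts within a class.
-/

namespace OrientedMatroid

open Function (support)

variable {α : Type*}

/-! ### Circuits and cocircuits -/

theorem sign_eq_one_or_neg_one {s : SignType} (hs : s ≠ 0) : s = 1 ∨ s = -1 := by
  decide +revert

theorem sign_eq_or_eq_neg {s t : SignType} (hs : s ≠ 0) (ht : t ≠ 0) : t = s ∨ t = -s := by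
  decide +revert

theorem sign_mul_nonneg {s t : SignType} (hs : 0 ≤ s) (ht : 0 ≤ t) : 0 ≤ s * t := by
  decide +revert

theorem sign_ne_neg_one_of_nonneg {s : SignType} (hs : 0 ≤ s) : s ≠ -1 := by
  decide +revert

@[simp]
theorem support_neg_sign (X : α → SignType) : support (-X) = support X := by
  ext; simp

theorem Orthogonal.symm {X Y : α → SignType} (h : Orthogonal X Y) : Orthogonal Y X := by
  simpa only [Orthogonal, mul_comm] using h

theorem Orthogonal.exists_mul_eq_neg_one {X Y : α → SignType} (h : Orthogonal X Y) {e : α}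
    (hX : X e ≠ 0) (hY : Y e ≠ 0) : ∃ f, X f * Y f = -1 :=
  (sign_eq_one_or_neg_one (mul_ne_zero hX hY)).elim (fun h1 => h.1 ⟨e, h1⟩) fun h1 => ⟨e, h1⟩

theorem Orthogonal.exists_mul_eq_one {X Y : α → SignType} (h : Orthogonal X Y) {e : α}
    (hX : X e ≠ 0) (hY : Y e ≠ 0) : ∃ f, X f * Y f = 1 :=
  (sign_eq_one_or_neg_one (mul_ne_zero hX hY)).elim (fun h1 => ⟨e, h1⟩) fun h1 => h.2 ⟨e, h1⟩

section Circuits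

variable {M : OrientedMatroid α}

theorem toMatroid_isCircuit_iff {C : Set α} :
    M.toMatroid.IsCircuit C ↔ ∃ X ∈ M.circuits, support X = C := by
  have hdep : ∀ {X}, X ∈ M.circuits → M.toMatroid.Dep (support X) := fun {X} hX =>
    ⟨fun h => h.2 X hX subset_rfl, M.support_subset X hX⟩
  have hex : ∀ {D : Set α}, M.toMatroid.Dep D → ∃ X ∈ M.circuits, support X ⊆ D := by
    intro D hD
    by_contra! h
    exact hD.1 ⟨hD.2, h⟩
  rw [Matroid.isCircuit_iff]
  constructor
  · rintro ⟨hC, hmin⟩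
    obtain ⟨X, hX, hXC⟩ := hex hC
    exact ⟨X, hX, hmin (hdep hX) hXC⟩
  · rintro ⟨X, hX, rfl⟩
    refine ⟨hdep hX, fun D hD hDX => hDX.antisymm ?_⟩
    obtain ⟨Y, hY, hYD⟩ := hex hD
    rcases M.incomparable Y hY X hX (hYD.trans hDX) with rfl | rfl
    · exact hYD
    · simpa using hYD

theorem isCircuit_support {X : α → SignType} (hX : X ∈ M.circuits) :
    M.toMatroid.IsCircuit (support X) :=
  toMatroid_isCircuit_iff.2 ⟨X, hX, rfl⟩

theorem exists_eq_zero_of_ne {X Y : α → SignType} (hX : X ∈ M.circuits) (hY : Y ∈ M.circuits)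
    (h₁ : X ≠ Y) (h₂ : X ≠ -Y) : ∃ g, X g ≠ 0 ∧ Y g = 0 := by
  by_contra! h
  exact (M.incomparable X hX Y hY h).elim h₁ h₂

theorem exists_circuit_elim {X Y : α → SignType} (hX : X ∈ M.circuits) (hY : Y ∈ M.circuits)
    (hne : X ≠ -Y) {e : α} (he : X e ≠ 0) (hXY : Y e = -X e) :
    ∃ Z ∈ M.circuits, Z e = 0 ∧ ∀ f, Z f ≠ 0 → Z f = X f ∨ Z f = Y f := by
  have sign_eq : ∀ a b c : SignType, ((c = 1 → a = 1 ∨ b = 1) ∧ (c = -1 → a = -1 ∨ b = -1)) →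
      c ≠ 0 → c = a ∨ c = b := by decide
  rcases sign_eq_one_or_neg_one he with h | h
  · obtain ⟨Z, hZ, hZe, hZf⟩ := M.elimination X hX Y hY hne e h (by rw [hXY, h])
    exact ⟨Z, hZ, hZe, fun f => sign_eq _ _ _ (hZf f)⟩
  · obtain ⟨Z, hZ, hZe, hZf⟩ := M.elimination Y hY X hX
      (fun h' => hne (by rw [h', neg_neg])) e (by rw [hXY, h, neg_neg]) h
    exact ⟨Z, hZ, hZe, fun f hf => (sign_eq _ _ _ (hZf f) hf).symm⟩

theorem exists_circuit_strong_elim {X Y : α → SignType} (hX : X ∈ M.circuits)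
    (hY : Y ∈ M.circuits) {e f : α} (heX : X e ≠ 0) (heY : Y e ≠ 0) (hfX : X f ≠ 0)
    (hfY : Y f = 0) :
    ∃ Z ∈ M.circuits, Z e = 0 ∧ Z f ≠ 0 ∧ support Z ⊆ support X ∪ support Y := by
  obtain ⟨C, hC, hCc, hf⟩ := (isCircuit_support hX).strong_elimination (isCircuit_support hY)
    heX heY hfX (by simpa using hfY)
  obtain ⟨Z, hZ, rfl⟩ := toMatroid_isCircuit_iff.1 hCc
  exact ⟨Z, hZ, by_contra fun h => (hC h).2 rfl, hf, hC.trans Set.sdiff_subset⟩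

theorem support_subset_union {X Y Z : α → SignType} (h : ∀ f, Z f ≠ 0 → Z f = X f ∨ Z f = Y f) :
    support Z ⊆ support X ∪ support Y := fun f hf =>
  (h f hf).imp (fun h => by rwa [Function.mem_support, ← h]) fun h => by
    rwa [Function.mem_support, ← h]

theorem exists_circuit_avoiding {X Y Z : α → SignType} (hX : X ∈ M.circuits)
    (hY : Y ∈ M.circuits) (hZ : Z ∈ M.circuits) (hZs : support Z ⊆ support X ∪ support Y) {e g : α}
    (hXe : X e ≠ 0) (hYe : Y e ≠ 0) (hZe : Z e = 0) (hYg : Y g = 0) (hZg : Z g = 0) :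
    ∃ T ∈ M.circuits, support T ⊆ support X ∪ support Y ∧ T e ≠ 0 ∧ T g = 0 ∧
      ∃ h, Y h ≠ 0 ∧ X h = 0 ∧ T h = 0 := by
  obtain ⟨h, hZh, hXh⟩ := exists_eq_zero_of_ne hZ hX (by rintro rfl; exact hXe hZe)
    (by rintro rfl; simp_all)
  have hYh : Y h ≠ 0 := (hZs hZh).resolve_left (not_not.2 hXh)
  obtain ⟨T, hT, hTh, hTe, hTs⟩ := exists_circuit_strong_elim hY hZ hYh hZh hYe hZe
  refine ⟨T, hT, hTs.trans (Set.union_subset Set.subset_union_right hZs), hTe, ?_, h, hYh, hXh, hTh⟩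
  exact by_contra fun hTg => (hTs hTg).elim (· hYg) (· hZg)

theorem exists_circuit_eq_and_eq {X Y : α → SignType} (hX : X ∈ M.circuits) (hY : Y ∈ M.circuits)
    {e f : α} (hXe : X e ≠ 0) (hYe : Y e = -X e) (hXf : X f ≠ 0) (hYf : Y f = X f)
    (hser : ∀ Z ∈ M.circuits, support Z ⊆ support X ∪ support Y → (Z e ≠ 0 ↔ Z f ≠ 0))
    (hmem : ∀ Z ∈ M.circuits, support Z ⊆ support X ∪ support Y → Z e = 0 →
      ∀ g, X g ≠ 0 → Y g = 0 → Z g ≠ 0) :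
    ∃ X' ∈ M.circuits, support X' ⊆ support X ∪ support Y ∧ X' e = X e ∧ X' f = X f ∧
      ∃ g, X g ≠ 0 ∧ Y g = 0 ∧ X' g = 0 := by
  have hXY : X ≠ Y := by
    rintro rfl
    exact hXe (SignType.neg_eq_self_iff.1 hYe.symm)
  have hXY' : X ≠ -Y := by
    rintro rfl
    exact hXf (SignType.neg_eq_self_iff.1 (by simpa using hYf.symm))
  obtain ⟨Z, hZ, hZe, hZs⟩ := exists_circuit_elim hX hY hXY' hXe hYe
  have hZXY := support_subset_union hZs
  have hZf : Z f = 0 := not_not.1 fun h => (hser Z hZ hZXY).2 h hZe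
  obtain ⟨g, hXg, hYg⟩ := exists_eq_zero_of_ne hX hY hXY hXY'
  have hZg : Z g ≠ 0 := hmem Z hZ hZXY hZe g hXg hYg
  obtain ⟨X', hX', hX'g, hX's⟩ := exists_circuit_elim hX (M.neg_mem Z hZ)
    (by rw [neg_neg]; rintro rfl; exact hXe hZe) hXg
    (by simp [(hZs g hZg).resolve_right (by rwa [hYg])])
  have hX'XY : support X' ⊆ support X ∪ support Y := (support_subset_union hX's).trans
    (Set.union_subset Set.subset_union_left (by simpa using hZXY))
  have hX'e : X' e ≠ 0 := fun h => hmem X' hX' hX'XY h g hXg hYg hX'g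
  have hX'f : X' f ≠ 0 := (hser X' hX' hX'XY).1 hX'e
  exact ⟨X', hX', hX'XY, (hX's e hX'e).resolve_right (by simpa [hZe] using hX'e),
    (hX's f hX'f).resolve_right (by simpa [hZf] using hX'f), g, hXg, hYg, hX'g⟩

theorem sign_mul_eq_of_series (U : Finset α) {e f : α}
    (hU : ∀ Z ∈ M.circuits, support Z ⊆ U → (Z e ≠ 0 ↔ Z f ≠ 0)) {X Y : α → SignType}
    (hX : X ∈ M.circuits) (hY : Y ∈ M.circuits) (hXU : support X ⊆ U) (hYU : support Y ⊆ U)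
    (hXe : X e ≠ 0) (hYe : Y e ≠ 0) : X e * X f = Y e * Y f := by
  classical
  induction U using Finset.strongInduction generalizing X Y with
  | H U ih =>
  have agree : ∀ {X Y : α → SignType} {g : α}, X ∈ M.circuits → Y ∈ M.circuits →
      support X ⊆ U → support Y ⊆ U → X e ≠ 0 → Y e ≠ 0 → g ∈ U → X g = 0 → Y g = 0 →
      X e * X f = Y e * Y f := by
    intro X Y g hX hY hXU hYU hXe hYe hg hXg hYg
    have avoid : ∀ {Z : α → SignType}, support Z ⊆ U → Z g = 0 → support Z ⊆ U.erase g :=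
      fun hZ hZg x hx => Finset.mem_erase.2 ⟨by rintro rfl; exact hx hZg, hZ hx⟩
    exact ih _ (Finset.erase_ssubset hg)
      (fun Z hZ h => hU Z hZ (h.trans (Finset.coe_subset.2 (Finset.erase_subset g U)))) hX hY
      (avoid hXU hXg) (avoid hYU hYg) hXe hYe
  by_contra hne
  wlog hYX : Y e = -X e ∧ Y f = X f generalizing Y
  · have signs : ∀ a b c d : SignType, a ≠ 0 → b ≠ 0 → c ≠ 0 → d ≠ 0 → a * b ≠ c * d →
        ¬(c = -a ∧ d = b) → -c = -a ∧ -d = b := by decide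
    exact this (M.neg_mem Y hY) (by simpa using hYU) (by simpa using hYe) (by simpa using hne)
      (signs _ _ _ _ hXe ((hU X hX hXU).1 hXe) hYe ((hU Y hY hYU).1 hYe) hne hYX)
  obtain ⟨hYe', hYf'⟩ := hYX
  have hXYU : support X ∪ support Y ⊆ U := Set.union_subset hXU hYU
  have mem_of_avoiding : ∀ Z ∈ M.circuits, support Z ⊆ support X ∪ support Y → Z e = 0 →
      ∀ g, X g ≠ 0 → Y g = 0 → Z g ≠ 0 := by
    intro Z hZ hZs hZe g hXg hYg hZg
    obtain ⟨T, hT, hTs, hTe, hTg, h, hYh, hXh, hTh⟩ :=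
      exists_circuit_avoiding hX hY hZ hZs hXe hYe hZe hYg hZg
    have hTU := hTs.trans hXYU
    exact hne ((agree hX hT hXU hTU hXe hTe (hYU hYh) hXh hTh).trans
      (agree hT hY hTU hYU hTe hYe (hXU hXg) hTg hYg))
  obtain ⟨X', hX', hX'XY, hX'e, hX'f, g, hXg, hYg, hX'g⟩ := exists_circuit_eq_and_eq hX hY hXe hYe'
    ((hU X hX hXU).1 hXe) hYf' (fun Z hZ hZs => hU Z hZ (hZs.trans hXYU)) mem_of_avoiding
  rw [← hX'e, ← hX'f] at hne
  exact hne (agree hX' hY (hX'XY.trans hXYU) hYU (by rwa [hX'e]) hYe (hXU hXg) hX'g hYg)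

end Circuits

section SignedCocircuits

variable {M : OrientedMatroid α}

/-- A set of elements that no circuit meets in exactly one element: the property of cocircuits on
which the construction of their signatures rests. -/
def Cocyclic (M : OrientedMatroid α) (D : Set α) : Prop :=
  ∀ X ∈ M.circuits, ∀ e ∈ D, X e ≠ 0 → ∃ f ∈ D, f ≠ e ∧ X f ≠ 0

variable {D : Set α} {e f : α} {X Y Z : α → SignType}

theorem Cocyclic.inter_eq_pair (hD : M.Cocyclic D) (hX : X ∈ M.circuits) (he : e ∈ D)
    (hXe : X e ≠ 0) (hef : ∀ x ∈ D, X x ≠ 0 → x = e ∨ x = f) : support X ∩ D = {e, f} := by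
  obtain ⟨g, hg, hge, hXg⟩ := hD X hX e he hXe
  obtain rfl := (hef g hg hXg).resolve_left hge
  refine Set.Subset.antisymm (fun x hx => hef x hx.2 hx.1) ?_
  rintro x (rfl | rfl)
  exacts [⟨hXe, he⟩, ⟨hXg, hg⟩]

theorem ne_zero_and_ne_zero_of_inter_eq_pair (hX : support X ∩ D = {e, f}) :
    X e ≠ 0 ∧ X f ≠ 0 :=
  ⟨(hX.symm ▸ Set.mem_insert e {f} : e ∈ support X ∩ D).1,
    (hX.symm ▸ Set.mem_insert_of_mem e rfl : f ∈ support X ∩ D).1⟩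

theorem Cocyclic.sign_mul_eq (hD : M.Cocyclic D) (hX : X ∈ M.circuits) (hY : Y ∈ M.circuits)
    (hXD : support X ∩ D = {e, f}) (hYD : support Y ∩ D = {e, f}) : X e * X f = Y e * Y f := by
  classical
  have he : e ∈ support X ∩ D := hXD ▸ Set.mem_insert e {f}
  have hf : f ∈ support X ∩ D := hXD ▸ Set.mem_insert_of_mem e rfl
  have sub : ∀ {Z}, Z ∈ M.circuits → support Z ∩ D = {e, f} →
      support Z ⊆ ({x ∈ M.E | x ∈ D → x = e ∨ x = f} : Finset α) := fun hZ hZD x hx =>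
    Finset.mem_filter.2 ⟨M.support_subset _ hZ hx, fun h => hZD.subset ⟨hx, h⟩⟩
  refine sign_mul_eq_of_series _ (fun Z hZ hZs => ?_) hX hY (sub hX hXD) (sub hY hYD) he.1
    (ne_zero_and_ne_zero_of_inter_eq_pair hYD).1
  have hZD : ∀ x ∈ D, Z x ≠ 0 → x = e ∨ x = f := fun x hx h => (Finset.mem_filter.1 (hZs h)).2 hx
  exact ⟨fun h => (ne_zero_and_ne_zero_of_inter_eq_pair (hD.inter_eq_pair hZ he.2 h hZD)).2,
    fun h => (ne_zero_and_ne_zero_of_inter_eq_pair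
      (hD.inter_eq_pair hZ hf.2 h fun x hx hZx => (hZD x hx hZx).symm)).2⟩

theorem Cocyclic.exists_pair_circuit_avoiding (hD : M.Cocyclic D) (hX : X ∈ M.circuits)
    (hXD : support X ∩ D = {e, f}) (hZ : Z ∈ M.circuits) (hZD : ∀ x ∈ D, Z x = 0) {g : α}
    (hXg : X g ≠ 0) (hZg : Z g ≠ 0) :
    ∃ T ∈ M.circuits, T g = 0 ∧ support T ⊆ support X ∪ support Z ∧ support T ∩ D = {e, f} := by
  have he : e ∈ support X ∩ D := hXD ▸ Set.mem_insert e {f}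
  obtain ⟨T, hT, hTg, hTe, hTs⟩ := exists_circuit_strong_elim hX hZ hXg hZg he.1 (hZD e he.2)
  refine ⟨T, hT, hTg, hTs, hD.inter_eq_pair hT he.2 hTe fun x hx hTx => ?_⟩
  exact hXD.subset ⟨(hTs hTx).resolve_right (not_not.2 (hZD x hx)), hx⟩

/-- An elimination of `f` between `Z` and a circuit with trace `{e, f}` may have an empty trace on
`D`; then it yields another circuit with trace `{e, f}`, closer to `Z`. -/
theorem Cocyclic.exists_elim (hD : M.Cocyclic D)
    (hY : ∀ X ∈ M.circuits, support X ∩ D = {e, f} → X e * Y e = -(X f * Y f))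
    (hZ : Z ∈ M.circuits) (hZf : Z f ≠ 0) (hZD : support Z ∩ D ≠ {e, f}) (U : Finset α)
    (hX : X ∈ M.circuits) (hXD : support X ∩ D = {e, f}) (hU : support Z ∪ support X ⊆ U) :
    ∃ Z' ∈ M.circuits, Z' f = 0 ∧ (∃ x ∈ D, Z' x ≠ 0) ∧
      ∀ x ∈ D, Z' x ≠ 0 → (x = e ∨ Z x ≠ 0) ∧ ∃ y ∈ D, Z y * Y y = Z' x * Y x := by
  classical
  induction U using Finset.strongInduction generalizing X with
  | H U ih =>
  have hf : f ∈ support X ∩ D := hXD ▸ Set.mem_insert_of_mem e rfl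
  wlog hs : X f = -Z f generalizing X
  · exact this (M.neg_mem X hX) (by simpa using hXD) (by simpa using hU) (by simpa using hf)
      (by simp [(sign_eq_or_eq_neg hZf hf.1).resolve_right hs])
  obtain ⟨Z', hZ', hZ'f, hZ's⟩ := exists_circuit_elim hZ hX
    (by rintro rfl; exact hZD (by simpa using hXD)) hZf hs
  by_cases hne : ∃ x ∈ D, Z' x ≠ 0
  · refine ⟨Z', hZ', hZ'f, hne, fun x hx hZ'x => ?_⟩
    rcases hZ's x hZ'x with h | h
    · exact ⟨Or.inr (h ▸ hZ'x), x, hx, by rw [h]⟩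
    · obtain rfl | rfl := hXD.subset ⟨show X x ≠ 0 from h ▸ hZ'x, hx⟩
      · exact ⟨Or.inl rfl, f, hf.2, by rw [h, hY X hX hXD, hs, neg_mul, neg_neg]⟩
      · exact absurd hZ'f hZ'x
  · push Not at hne
    obtain ⟨g, hZ'g, hZg⟩ := exists_eq_zero_of_ne hZ' hZ (by rintro rfl; exact hZf hZ'f)
      (by rintro rfl; exact hZf (by simpa using hZ'f))
    have hZ'ZX := support_subset_union hZ's
    have hXg : X g ≠ 0 := (hZ'ZX hZ'g).resolve_left (not_not.2 hZg)
    obtain ⟨T, hT, hTg, hTs, hTD⟩ :=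
      hD.exists_pair_circuit_avoiding hX hXD hZ' hne hXg hZ'g
    refine ih _ (Finset.erase_ssubset (hU (Or.inr hXg))) hT hTD fun x hx => ?_
    refine Finset.mem_erase.2 ⟨by rintro rfl; exact hx.elim (· hZg) (· hTg), hU ?_⟩
    exact hx.elim Or.inl fun h => (hTs h).elim Or.inr fun h => hZ'ZX h

theorem Cocyclic.exists_mul_eq_neg_one (hD : M.Cocyclic D) (he : e ∈ D) (hYD : ∀ x ∈ D, Y x ≠ 0)
    (hpair : ∀ f ∈ D, f ≠ e → ∃ X ∈ M.circuits, support X ∩ D = {e, f})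
    (hY : ∀ f ∈ D, f ≠ e → ∀ X ∈ M.circuits, support X ∩ D = {e, f} → X e * Y e = -(X f * Y f))
    (hZ : Z ∈ M.circuits) (hZD : ∃ x ∈ D, Z x ≠ 0) (U : Finset α)
    (hU : ∀ x ∈ D, x ≠ e → Z x ≠ 0 → x ∈ U) : ∃ y ∈ D, Z y * Y y = -1 := by
  classical
  induction U using Finset.strongInduction generalizing Z with
  | H U ih =>
  obtain ⟨f, hf, hfe, hZf⟩ : ∃ f ∈ D, f ≠ e ∧ Z f ≠ 0 := by
    obtain ⟨x, hx, hZx⟩ := hZD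
    rcases eq_or_ne x e with rfl | h
    exacts [hD Z hZ x hx hZx, ⟨x, hx, h, hZx⟩]
  by_cases hZef : support Z ∩ D = {e, f}
  · rcases sign_eq_one_or_neg_one (mul_ne_zero hZf (hYD f hf)) with h | h
    exacts [⟨e, he, by rw [hY f hf hfe Z hZ hZef, h]⟩, ⟨f, hf, h⟩]
  · obtain ⟨X, hX, hXD⟩ := hpair f hf hfe
    have hE : support Z ∪ support X ⊆ M.E :=
      Set.union_subset (M.support_subset Z hZ) (M.support_subset X hX)
    obtain ⟨Z', hZ', hZ'f, hZ'D, hZ's⟩ := hD.exists_elim (hY f hf hfe) hZ hZf hZef M.E hX hXD hE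
    obtain ⟨x, hx, hZ'x⟩ := ih _ (Finset.erase_ssubset (hU f hf hfe hZf)) hZ' hZ'D
      fun x hx hxe hZ'x => Finset.mem_erase.2 ⟨by rintro rfl; exact hZ'x hZ'f,
        hU x hx hxe ((hZ's x hx hZ'x).1.resolve_left hxe)⟩
    obtain ⟨y, hy, hZy⟩ := (hZ's x hx (left_ne_zero_of_mul (by rw [hZ'x]; decide))).2
    exact ⟨y, hy, hZy.trans hZ'x⟩

theorem orthogonal_of_exists_mul_eq_neg_one
    (h : ∀ X ∈ M.circuits, (∃ x, X x * Y x ≠ 0) → ∃ y, X y * Y y = -1) (hX : X ∈ M.circuits) :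
    Orthogonal X Y := by
  refine ⟨fun ⟨x, hx⟩ => h X hX ⟨x, by rw [hx]; decide⟩, fun ⟨x, hx⟩ => ?_⟩
  obtain ⟨y, hy⟩ := h (-X) (M.neg_mem X hX) ⟨x, by simp [hx]⟩
  exact ⟨y, by simpa using hy⟩

theorem Cocyclic.exists_signature (hD : M.Cocyclic D) (hne : D.Nonempty)
    (hpair : ∀ e ∈ D, ∀ f ∈ D, f ≠ e → ∃ X ∈ M.circuits, support X ∩ D = {e, f}) :
    ∃ Y : α → SignType, support Y = D ∧ ∀ X ∈ M.circuits, Orthogonal X Y := by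
  classical
  obtain ⟨e, he⟩ := hne
  choose! C hC hCD using hpair e he
  let Y : α → SignType := fun f => if f ∈ D then (if f = e then 1 else -(C f e * C f f)) else 0
  have hYe : Y e = 1 := by simp [Y, he]
  have hYf : ∀ f ∈ D, f ≠ e → Y f = -(C f e * C f f) := fun f hf hfe => by simp [Y, hf, hfe]
  have hYD : ∀ f ∈ D, Y f ≠ 0 := by
    intro f hf
    rcases eq_or_ne f e with rfl | hfe
    · simp [hYe]
    · have hCf := ne_zero_and_ne_zero_of_inter_eq_pair (hCD f hf hfe)
      simp [hYf f hf hfe, hCf]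
  have hY0 : ∀ f, f ∉ D → Y f = 0 := fun f hf => by simp [Y, hf]
  have hYpair : ∀ f ∈ D, f ≠ e → ∀ X ∈ M.circuits, support X ∩ D = {e, f} →
      X e * Y e = -(X f * Y f) := by
    intro f hf hfe X hX hXD
    have signs : ∀ a b : SignType, b ≠ 0 → a * 1 = -(b * -(a * b)) := by decide
    rw [hYe, hYf f hf hfe, ← hD.sign_mul_eq hX (hC f hf hfe) hXD (hCD f hf hfe)]
    exact signs _ _ (ne_zero_and_ne_zero_of_inter_eq_pair hXD).2
  refine ⟨Y, Set.ext fun f => ⟨fun h => by_contra fun hf => h (hY0 f hf), hYD f⟩,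
    fun X => orthogonal_of_exists_mul_eq_neg_one fun Z hZ ⟨x, hx⟩ => ?_⟩
  have hxD : x ∈ D := by_contra fun h => right_ne_zero_of_mul hx (hY0 x h)
  obtain ⟨y, -, hy⟩ := hD.exists_mul_eq_neg_one he hYD (hpair e he) hYpair hZ
    ⟨x, hxD, left_ne_zero_of_mul hx⟩ M.E fun y _ _ hy => M.support_subset Z hZ hy
  exact ⟨y, hy⟩

theorem cocyclic_of_isCocircuit (hD : M.toMatroid.IsCocircuit D) : M.Cocyclic D := by
  intro X hX e he hXe
  by_contra! h
  refine (isCircuit_support hX).inter_isCocircuit_ne_singleton hD (e := e) ?_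
  refine Set.eq_singleton_iff_unique_mem.2 ⟨⟨hXe, he⟩, fun x hx => ?_⟩
  exact by_contra fun hxe => hx.1 (h x hx.2 hxe)

theorem exists_circuit_inter_eq_pair (hD : M.toMatroid.IsCocircuit D) (he : e ∈ D) (hf : f ∈ D)
    (hfe : f ≠ e) : ∃ X ∈ M.circuits, support X ∩ D = {e, f} := by
  have hspanning : M.toMatroid.Spanning (M.toMatroid.E \ (D \ {e})) := by
    by_contra h
    exact ((Matroid.isCocircuit_iff_minimal_compl_nonspanning.1 hD).le_of_le h
      Set.sdiff_subset he).2 rfl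
  have hfcl : f ∈ M.toMatroid.closure (M.toMatroid.E \ (D \ {e})) := by
    rw [hspanning.closure_eq]
    exact hD.subset_ground hf
  obtain ⟨C, hCs, hC, hfC⟩ := Matroid.exists_isCircuit_of_mem_closure hfcl
    (fun h => h.2 ⟨hf, hfe⟩)
  obtain ⟨X, hX, rfl⟩ := toMatroid_isCircuit_iff.1 hC
  refine ⟨X, hX, Set.pair_comm f e ▸
    (cocyclic_of_isCocircuit hD).inter_eq_pair hX hf hfC fun x hx hXx => ?_⟩
  exact (hCs hXx).imp id fun h => by_contra fun hxe => h.2 ⟨hx, hxe⟩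

theorem exists_cocircuit_support_eq (hD : M.toMatroid.IsCocircuit D) :
    ∃ Y ∈ M.cocircuits, support Y = D := by
  obtain ⟨Y, hY, hYo⟩ := (cocyclic_of_isCocircuit hD).exists_signature hD.nonempty
    fun e he f hf hfe => exists_circuit_inter_eq_pair hD he hf hfe
  exact ⟨Y, ⟨hY ▸ hD, hYo⟩, hY⟩

theorem neg_mem_cocircuits (hY : Y ∈ M.cocircuits) : -Y ∈ M.cocircuits := by
  refine ⟨by simpa using hY.1, fun X hX => ?_⟩
  have := hY.2 (-X) (M.neg_mem X hX)
  simpa [Orthogonal] using this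

theorem exists_isCocircuit_of_notMem_closure {S : Set α} (he : e ∈ M.E)
    (hcl : e ∉ M.toMatroid.closure S) :
    ∃ D, M.toMatroid.IsCocircuit D ∧ e ∈ D ∧ Disjoint D S := by
  obtain ⟨I, hI⟩ := M.toMatroid.exists_isBasis' S
  rw [← hI.closure_eq_closure] at hcl
  have heI : e ∉ I := fun h => hcl (M.toMatroid.mem_closure_of_mem h hI.indep.subset_ground)
  have hins : M.toMatroid.Indep (insert e I) :=
    ((hI.indep.notMem_closure_iff (show e ∈ M.toMatroid.E from he)).1 hcl).1
  obtain ⟨B, hB, hIB⟩ := hins.exists_isBase_superset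
  have heB : e ∈ B := hIB (Set.mem_insert _ _)
  have hIB' : I ⊆ B \ {e} :=
    Set.subset_sdiff_singleton ((Set.subset_insert e I).trans hIB) heI
  refine ⟨_, hB.compl_closure_sdiff_singleton_isCocircuit heB,
    ⟨he, hB.indep.notMem_closure_sdiff_of_mem heB⟩, Set.disjoint_left.2 ?_⟩
  rintro x ⟨hxE, hx⟩ hxS
  refine hx (M.toMatroid.closure_subset_closure hIB' ?_)
  rw [hI.closure_eq_closure]
  exact M.toMatroid.mem_closure_of_mem' hxS hxE

end SignedCocircuits

/-! ### Dual pairs of sign vectors -/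

section Painting

theorem exists_sign_eq_one {V : Set (α → SignType)} (hV : ∀ X ∈ V, -X ∈ V) {X : α → SignType}
    (hX : X ∈ V) {e : α} (he : X e ≠ 0) : ∃ Y ∈ V, Y e = 1 ∧ support Y = support X := by
  rcases sign_eq_one_or_neg_one he with h | h
  exacts [⟨X, hX, h, rfl⟩, ⟨-X, hV X hX, by simp [h], support_neg_sign X⟩]

/-- The first alternative of the 3-painting lemma: `V` has a vector that is positive at `e`,
vanishes on the red elements `R` and is nonnegative off the green elements `G`. -/
def PaintedAt (V : Set (α → SignType)) (e : α) (R G : Set α) : Prop :=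
  ∃ X ∈ V, X e = 1 ∧ (∀ x ∈ R, X x = 0) ∧ ∀ x ∉ G, 0 ≤ X x

/-- Dual families of sign vectors on `E`, axiomatised by orthogonality and Minty's 3-painting
lemma; the signed circuits and cocircuits of an oriented matroid are the example. The two families
play symmetric roles, so that a statement about one of them dualises by `DualPair.symm`. -/
structure DualPair (E : Finset α) (V W : Set (α → SignType)) : Prop where
  support_left : ∀ X ∈ V, support X ⊆ E
  support_right : ∀ Y ∈ W, support Y ⊆ E
  orthogonal : ∀ X ∈ V, ∀ Y ∈ W, Orthogonal X Y
  neg_left : ∀ X ∈ V, -X ∈ V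
  neg_right : ∀ Y ∈ W, -Y ∈ W
  painting : ∀ e ∈ E, ∀ R G : Set α, e ∉ R → e ∉ G → Disjoint R G →
    PaintedAt V e R G ∨ PaintedAt W e G R

theorem DualPair.symm {E : Finset α} {V W : Set (α → SignType)} (h : DualPair E V W) :
    DualPair E W V where
  support_left := h.support_right
  support_right := h.support_left
  orthogonal X hX Y hY := (h.orthogonal Y hY X hX).symm
  neg_left := h.neg_right
  neg_right := h.neg_left
  painting e he R G hR hG hRG := (h.painting e he G R hG hR hRG.symm).symm

theorem Orthogonal.nonneg_or_nonneg {X Y : α → SignType} (h : Orthogonal X Y) {f : α}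
    {R G : Set α} (hXR : ∀ x ∈ R, X x = 0) (hXG : ∀ x ∉ insert f G, 0 ≤ X x)
    (hYG : ∀ x ∈ G, Y x = 0) (hYR : ∀ x ∉ insert f R, 0 ≤ Y x) : 0 ≤ X f ∨ 0 ≤ Y f := by
  by_contra! hneg
  obtain ⟨x, hx⟩ := h.exists_mul_eq_neg_one hneg.1.ne hneg.2.ne
  have hxf : x ≠ f := by
    rintro rfl
    rw [SignType.neg_iff.1 hneg.1, SignType.neg_iff.1 hneg.2] at hx
    exact absurd hx (by decide)
  have hxR : x ∉ R := fun h => by simp [hXR x h] at hx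
  have hxG : x ∉ G := fun h => by simp [hYG x h] at hx
  exact sign_ne_neg_one_of_nonneg
    (sign_mul_nonneg (hXG x (by simp [hxf, hxG])) (hYR x (by simp [hxf, hxR]))) hx

variable (M : OrientedMatroid α)

theorem exists_circuit_of_mem_closure {e : α} {S : Set α} (hS : e ∉ S)
    (he : e ∈ M.toMatroid.closure S) :
    ∃ X ∈ M.circuits, X e = 1 ∧ support X ⊆ insert e S := by
  obtain ⟨C, hCs, hC, heC⟩ := Matroid.exists_isCircuit_of_mem_closure he hS
  obtain ⟨X, hX, rfl⟩ := toMatroid_isCircuit_iff.1 hC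
  obtain ⟨X', hX', hX'e, hX's⟩ := exists_sign_eq_one M.neg_mem hX heC
  exact ⟨X', hX', hX'e, hX's ▸ hCs⟩

theorem exists_cocircuit_of_notMem_closure {e : α} {S : Set α} (heE : e ∈ M.E)
    (he : e ∉ M.toMatroid.closure S) :
    ∃ Y ∈ M.cocircuits, Y e = 1 ∧ ∀ x ∈ S, Y x = 0 := by
  obtain ⟨D, hD, heD, hDS⟩ := exists_isCocircuit_of_notMem_closure heE he
  obtain ⟨Y, hY, rfl⟩ := exists_cocircuit_support_eq hD
  obtain ⟨Y', hY', hY'e, hY's⟩ := exists_sign_eq_one (fun _ => neg_mem_cocircuits) hY heD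
  exact ⟨Y', hY', hY'e, fun x hx => by_contra fun h =>
    Set.disjoint_left.1 hDS (hY's.subset h) hx⟩

theorem paintedAt_of_two_colours {e : α} (he : e ∈ M.E) {R G : Set α} (hR : e ∉ R) (hG : e ∉ G)
    (hRG : Disjoint R G) (hcover : ∀ x ∈ M.E, x ∈ R ∨ x ∈ G ∨ x = e) :
    PaintedAt M.circuits e R G ∨ PaintedAt M.cocircuits e G R := by
  by_cases hcl : e ∈ M.toMatroid.closure G
  · obtain ⟨X, hX, hXe, hXs⟩ := M.exists_circuit_of_mem_closure hG hcl
    have hX0 : ∀ x, x ≠ e → x ∉ G → X x = 0 := fun x hxe hx =>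
      by_contra fun h => (hXs h).elim hxe hx
    refine Or.inl ⟨X, hX, hXe,
      fun x hx => hX0 x (by rintro rfl; exact hR hx) (Set.disjoint_left.1 hRG hx), fun x hx => ?_⟩
    rcases eq_or_ne x e with rfl | hxe
    exacts [by rw [hXe]; decide, (hX0 x hxe hx).ge]
  · obtain ⟨Y, hY, hYe, hYG⟩ := M.exists_cocircuit_of_notMem_closure he hcl
    refine Or.inr ⟨Y, hY, hYe, hYG, fun x hx => ?_⟩
    by_cases hxE : x ∈ M.E
    · rcases hcover x hxE with h | h | rfl
      exacts [absurd h hx, (hYG x h).ge, by rw [hYe]; decide]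
    · exact (not_not.1 fun h => hxE (hY.1.subset_ground h)).ge

theorem paintedAt_or_paintedAt {e : α} (he : e ∈ M.E) (B : Finset α) (R G : Set α) (hR : e ∉ R)
    (hG : e ∉ G) (hRG : Disjoint R G) (hB : ∀ x ∈ M.E, x ∉ B → x ∈ R ∨ x ∈ G ∨ x = e) :
    PaintedAt M.circuits e R G ∨ PaintedAt M.cocircuits e G R := by
  classical
  induction B using Finset.induction generalizing R G with
  | empty => exact M.paintedAt_of_two_colours he hR hG hRG fun x hx => hB x hx (by simp)
  | insert f B _ ih =>
  by_cases hf : f ∈ R ∨ f ∈ G ∨ f = e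
  · refine ih R G hR hG hRG fun x hx hxB => ?_
    rcases eq_or_ne x f with rfl | hxf
    exacts [hf, hB x hx (by simp [hxf, hxB])]
  push Not at hf
  obtain ⟨hfR, hfG, hfe⟩ := hf
  have hB' : ∀ x ∈ M.E, x ∉ B → x = f ∨ x ∈ R ∨ x ∈ G ∨ x = e := fun x hx hxB =>
    or_iff_not_imp_left.2 fun hxf => hB x hx (by simp [hxf, hxB])
  have green := ih R (insert f G) hR (by simp [hfe.symm, hG]) (by simp [hfR, hRG])
    fun x hx hxB => by have := hB' x hx hxB; grind
  have red := ih (insert f R) G (by simp [hfe.symm, hR]) hG (by simp [hfG, hRG])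
    fun x hx hxB => by have := hB' x hx hxB; grind
  rcases green with ⟨X, hX, hXe, hXR, hXG⟩ | ⟨Y, hY, hYe, hYG, hYR⟩
  swap
  · exact Or.inr ⟨Y, hY, hYe, fun x hx => hYG x (Or.inr hx), hYR⟩
  rcases red with ⟨X', hX', hX'e, hX'R, hX'G⟩ | ⟨Y, hY, hYe, hYG, hYR⟩
  · exact Or.inl ⟨X', hX', hX'e, fun x hx => hX'R x (Or.inr hx), hX'G⟩
  have extend : ∀ {T : α → SignType} {G : Set α}, 0 ≤ T f → (∀ x ∉ insert f G, 0 ≤ T x) →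
      ∀ x ∉ G, 0 ≤ T x := fun {T G} hTf hT x hx => by
    rcases eq_or_ne x f with rfl | hxf
    exacts [hTf, hT x (by simp [hxf, hx])]
  rcases (hY.2 X hX).nonneg_or_nonneg hXR hXG hYG hYR with hXf | hYf
  exacts [Or.inl ⟨X, hX, hXe, hXR, extend hXf hXG⟩, Or.inr ⟨Y, hY, hYe, hYG, extend hYf hYR⟩]

theorem dualPair : DualPair M.E M.circuits M.cocircuits where
  support_left := M.support_subset
  support_right _ hY := hY.1.subset_ground
  orthogonal X hX _ hY := hY.2 X hX
  neg_left := M.neg_mem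
  neg_right _ := neg_mem_cocircuits
  painting _ he R G hR hG hRG :=
    M.paintedAt_or_paintedAt he M.E R G hR hG hRG fun _ hx h => absurd hx h

end Painting

section Reorientation

variable [LinearOrder α]

theorem preimage_flip_preimage_flip (S : Finset α) (V : Set (α → SignType)) :
    flip S ⁻¹' (flip S ⁻¹' V) = V := by
  ext X
  rw [Set.mem_preimage, Set.mem_preimage, flip_flip]

theorem flip_comp (A B : Finset α) (X : α → SignType) :
    flip A (flip B X) = flip (symmDiff A B) X := by
  funext e
  by_cases hA : e ∈ A <;> by_cases hB : e ∈ B <;> simp [flip, hA, hB, Finset.mem_symmDiff]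

theorem orthogonal_flip_iff (A : Finset α) (X Y : α → SignType) :
    Orthogonal (flip A X) (flip A Y) ↔ Orthogonal X Y := by
  have h : ∀ e, flip A X e * flip A Y e = X e * Y e := fun e => by
    by_cases h : e ∈ A <;> simp [flip, h]
  simp only [Orthogonal, h]

variable (M : OrientedMatroid α)

theorem circuits_reorient (A : Finset α) : (M.reorient A).circuits = flip A ⁻¹' M.circuits := rfl

theorem reorient_reorient (A B : Finset α) :
    (M.reorient A).reorient B = M.reorient (symmDiff A B) := by
  have h : ((M.reorient A).reorient B).circuits = (M.reorient (symmDiff A B)).circuits := by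
    ext X
    simp only [circuits_reorient, Set.mem_preimage, flip_comp]
  simpa only [reorient, mk.injEq, true_and] using h

theorem reorient_toMatroid (A : Finset α) : (M.reorient A).toMatroid = M.toMatroid := by
  refine Matroid.ext_isCircuit rfl fun C _ => ?_
  rw [toMatroid_isCircuit_iff, toMatroid_isCircuit_iff, circuits_reorient]
  constructor
  · rintro ⟨X, hX, rfl⟩
    exact ⟨flip A X, hX, support_flip A X⟩
  · rintro ⟨X, hX, rfl⟩
    exact ⟨flip A X, by rwa [Set.mem_preimage, flip_flip], support_flip A X⟩

theorem cocircuits_reorient (A : Finset α) :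
    (M.reorient A).cocircuits = flip A ⁻¹' M.cocircuits := by
  ext Y
  simp only [cocircuits, reorient_toMatroid, circuits_reorient, Set.mem_ofPred_eq,
    Set.mem_preimage, support_flip]
  refine and_congr Iff.rfl ⟨fun h X hX => ?_, fun h X hX => ?_⟩
  · rw [← orthogonal_flip_iff A, flip_flip]
    exact h _ (by rwa [flip_flip])
  · rw [← orthogonal_flip_iff A]
    exact h _ hX

end Reorientation

/-! ### Activities of minors -/

section Minors

/-- The ground set `E` is split into the ground set `F` of a minor, the contracted elements `C` and
the deleted elements `D`. Both `C` and `D` may contain elements outside `E`. -/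
structure MinorSplit (E F : Finset α) (C D : Set α) : Prop where
  subset : F ⊆ E
  disjoint_contracted : Disjoint ↑F C
  disjoint_deleted : Disjoint ↑F D
  disjoint : Disjoint C D
  cover : ∀ x ∈ E, x ∈ F ∨ x ∈ C ∨ x ∈ D

namespace MinorSplit

variable {E F : Finset α} {C D : Set α} {w : α}

theorem ground (E : Finset α) : MinorSplit E E ∅ ∅ :=
  ⟨subset_rfl, by simp, by simp, by simp, fun _ hx => Or.inl hx⟩

theorem symm (h : MinorSplit E F C D) : MinorSplit E F D C :=
  ⟨h.subset, h.disjoint_deleted, h.disjoint_contracted, h.disjoint.symm,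
    fun x hx => (h.cover x hx).imp_right Or.symm⟩

theorem contract [DecidableEq α] (h : MinorSplit E (insert w F) C D) (hw : w ∉ F) :
    MinorSplit E F (insert w C) D where
  subset := (Finset.subset_insert w F).trans h.subset
  disjoint_contracted := by
    have := h.disjoint_contracted
    simp_all
  disjoint_deleted := h.disjoint_deleted.mono_left (by simp)
  disjoint := by
    have := h.disjoint_deleted
    have := h.disjoint
    simp_all
  cover x hx := by
    have := h.cover x hx
    grind

theorem delete [DecidableEq α] (h : MinorSplit E (insert w F) C D) (hw : w ∉ F) :
    MinorSplit E F C (insert w D) :=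
  (h.symm.contract hw).symm

end MinorSplit

theorem DualPair.mem_of_mul_ne_zero {E F : Finset α} {C D : Set α} {V W : Set (α → SignType)}
    (hp : DualPair E V W) (hs : MinorSplit E F C D) {X Y : α → SignType} (hX : X ∈ V)
    (hXD : ∀ x ∈ D, X x = 0) (hYC : ∀ x ∈ C, Y x = 0) {x : α} (hx : X x * Y x ≠ 0) : x ∈ F := by
  obtain ⟨hXx, hYx⟩ := mul_ne_zero_iff.1 hx
  rcases hs.cover x (hp.support_left X hX hXx) with h | h | h
  exacts [h, absurd (hYC x h) hYx, absurd (hXD x h) hXx]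

end Minors

section Minima

variable [LinearOrder α]

/-- On the minor with ground set `F` obtained by deleting `Z` and contracting all other elements,
some vector of `V` is nonnegative and has minimum `a`. -/
def HasMin (V : Set (α → SignType)) (F : Finset α) (Z : Set α) (a : α) : Prop :=
  ∃ X ∈ V, X a = 1 ∧ (∀ x ∈ Z, X x = 0) ∧ ∀ x ∈ F, 0 ≤ X x ∧ (x < a → X x = 0)

open Classical in
/-- The minima of the nonnegative vectors of `V` on the minor with ground set `F` obtained by
deleting `Z` and contracting all other elements. -/
noncomputable def minima (V : Set (α → SignType)) (F : Finset α) (Z : Set α) : Finset α :=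
  {a ∈ F | HasMin V F Z a}

/-- The vectors of `V` that take the value `s` at `w`. -/
def withSign (V : Set (α → SignType)) (w : α) (s : SignType) : Set (α → SignType) :=
  {X ∈ V | X w = s}

variable {E F : Finset α} {V W : Set (α → SignType)} {C D Z : Set α} {a w : α}

theorem mem_minima : a ∈ minima V F Z ↔ a ∈ F ∧ HasMin V F Z a := by
  simp [minima]

theorem minima_subset (V : Set (α → SignType)) (F : Finset α) (Z : Set α) : minima V F Z ⊆ F :=
  fun _ ha => (mem_minima.1 ha).1

theorem minima_insert_subset (V : Set (α → SignType)) (F : Finset α) (Z : Set α) (w : α) :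
    minima V F (insert w Z) ⊆ minima V F Z := fun a ha => by
  obtain ⟨haF, X, hX, hXa, hXZ, hXF⟩ := mem_minima.1 ha
  exact mem_minima.2 ⟨haF, X, hX, hXa, fun x hx => hXZ x (Or.inr hx), hXF⟩

theorem minima_insert_eq_withSign_zero (V : Set (α → SignType)) (F : Finset α) (Z : Set α)
    (w : α) : minima V F (insert w Z) = minima (withSign V w 0) F Z := by
  ext a
  simp only [mem_minima, HasMin, withSign, Set.mem_ofPred_eq, Set.forall_mem_insert]
  grind

theorem minima_eq_union_withSign (V : Set (α → SignType)) (F : Finset α) (Z : Set α) (w : α) :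
    minima V F Z = minima (withSign V w (-1)) F Z ∪
      (minima (withSign V w 1) F Z ∪ minima (withSign V w 0) F Z) := by
  ext a
  have signs : ∀ s : SignType, s = -1 ∨ s = 1 ∨ s = 0 := by decide
  simp only [Finset.mem_union, mem_minima, HasMin, withSign, Set.mem_ofPred_eq]
  constructor
  · rintro ⟨ha, X, hX, h⟩
    grind [signs (X w)]
  · grind

theorem erase_minima_insert (V : Set (α → SignType)) (Z : Set α) (hw : ∀ x ∈ F, x < w) :
    (minima V (insert w F) Z).erase w =
      minima (withSign V w 1) F Z ∪ minima (withSign V w 0) F Z := by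
  ext a
  have signs : ∀ s : SignType, 0 ≤ s ↔ s = 1 ∨ s = 0 := by decide
  simp only [Finset.mem_erase, Finset.mem_union, mem_minima, HasMin, withSign,
    Set.mem_ofPred_eq, Finset.mem_insert]
  constructor
  · rintro ⟨haw, ha, X, hX, h⟩
    grind
  · rintro (⟨ha, X, h⟩ | ⟨ha, X, h⟩) <;> have := hw a ha <;> grind

theorem hasMin_insert_self (hw : ∀ x ∈ F, x < w) : HasMin V (insert w F) Z w ↔
    ∃ X ∈ V, X w = 1 ∧ (∀ x ∈ Z, X x = 0) ∧ ∀ x ∈ F, X x = 0 := by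
  have signs : ∀ s : SignType, s = 0 ∨ s = 1 → 0 ≤ s := by decide
  constructor
  · rintro ⟨X, hX, hXw, hXZ, hXF⟩
    exact ⟨X, hX, hXw, hXZ, fun x hx => (hXF x (Finset.mem_insert_of_mem hx)).2 (hw x hx)⟩
  · rintro ⟨X, hX, hXw, hXZ, hXF⟩
    refine ⟨X, hX, hXw, hXZ, fun x hx => ?_⟩
    rcases Finset.mem_insert.1 hx with rfl | hx
    exacts [⟨signs _ (Or.inr hXw), fun h => absurd h (lt_irrefl _)⟩,
      ⟨signs _ (Or.inl (hXF x hx)), fun _ => hXF x hx⟩]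

theorem minima_preimage_flip (V : Set (α → SignType)) (Z : Set α) (hw : w ∉ F) :
    minima (flip {w} ⁻¹' V) F Z = minima V F Z := by
  have flip_apply : ∀ (X : α → SignType), ∀ x ∈ F, flip {w} X x = X x := fun X x hx =>
    if_neg fun h => hw (by rwa [← Finset.mem_singleton.1 h])
  have flip_eq_zero : ∀ (X : α → SignType) x, flip {w} X x = 0 ↔ X x = 0 := fun X x =>
    not_iff_not.1 (Set.ext_iff.1 (support_flip {w} X) x)
  have subset : ∀ V, minima (flip {w} ⁻¹' V) F Z ⊆ minima V F Z := fun V a ha => by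
    obtain ⟨haF, X, hX, hXa, hXZ, hXF⟩ := mem_minima.1 ha
    refine mem_minima.2 ⟨haF, flip {w} X, hX, by rwa [flip_apply X a haF],
      fun x hx => (flip_eq_zero X x).2 (hXZ x hx), fun x hx => ?_⟩
    rw [flip_apply X x hx]
    exact hXF x hx
  refine (subset V).antisymm ?_
  simpa only [preimage_flip_preimage_flip] using subset (flip {w} ⁻¹' V)

theorem withSign_preimage_flip (V : Set (α → SignType)) (w : α) (s : SignType) :
    withSign (flip {w} ⁻¹' V) w s = flip {w} ⁻¹' withSign V w (-s) := by
  ext X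
  simp [withSign, flip, neg_inj]

theorem minima_withSign_preimage_flip (V : Set (α → SignType)) (Z : Set α) (hw : w ∉ F)
    (s : SignType) :
    minima (withSign (flip {w} ⁻¹' V) w s) F Z = minima (withSign V w (-s)) F Z := by
  rw [withSign_preimage_flip, minima_preimage_flip _ _ hw]

theorem erase_minima_of_subset (hw : ∀ x ∈ F, x < w)
    (h : minima (withSign V w 1) F Z ⊆ minima (withSign V w 0) F Z) :
    (minima V (insert w F) Z).erase w = minima V F (insert w Z) ∧
      (minima (flip {w} ⁻¹' V) (insert w F) Z).erase w = minima V F Z := by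
  have hwF : w ∉ F := fun h => lt_irrefl w (hw w h)
  rw [erase_minima_insert _ _ hw, erase_minima_insert _ _ hw,
    minima_insert_eq_withSign_zero, minima_eq_union_withSign V F Z w,
    minima_withSign_preimage_flip _ _ hwF, minima_withSign_preimage_flip _ _ hwF, neg_zero,
    Finset.union_eq_right.2 h]
  exact ⟨rfl, rfl⟩

theorem DualPair.exists_of_not_hasMin (hp : DualPair E V W) (hs : MinorSplit E F C D) (ha : a ∈ F)
    (h : ¬ HasMin V F D a) :
    ∃ Y ∈ W, Y a = 1 ∧ (∀ x ∈ C, Y x = 0) ∧ ∀ x ∈ F, a ≤ x → 0 ≤ Y x := by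
  have hFD : ∀ x ∈ F, x ∉ D := fun x hx => Set.disjoint_left.1 hs.disjoint_deleted hx
  have hFC : ∀ x ∈ F, x ∉ C := fun x hx => Set.disjoint_left.1 hs.disjoint_contracted hx
  have hdisj : Disjoint (D ∪ {x | x ∈ F ∧ x < a}) C := by
    refine Disjoint.sup_left hs.disjoint.symm (Set.disjoint_left.2 fun x hx => hFC x hx.1)
  rcases hp.painting a (hs.subset ha) (D ∪ {x | x ∈ F ∧ x < a}) C (by simp [hFD a ha]) (hFC a ha)
    hdisj with ⟨X, hX, hXa, hX0, hXC⟩ | ⟨Y, hY, hYa, hYC, hYnn⟩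
  · exact absurd ⟨X, hX, hXa, fun x hx => hX0 x (Or.inl hx),
      fun x hx => ⟨hXC x (hFC x hx), fun hxa => hX0 x (Or.inr ⟨hx, hxa⟩)⟩⟩ h
  · refine ⟨Y, hY, hYa, hYC, fun x hx hax => hYnn x ?_⟩
    rintro (h | h)
    exacts [hFD x hx h, hax.not_gt h.2]

theorem DualPair.mul_eq_neg_one_of_nonneg (hp : DualPair E V W) (hs : MinorSplit E (insert w F) C D)
    {X Y : α → SignType} (hX : X ∈ V) (hY : Y ∈ W) (hXD : ∀ x ∈ D, X x = 0)
    (hYC : ∀ x ∈ C, Y x = 0) (hXY : ∀ x ∈ F, 0 ≤ X x * Y x) {e : α} (he : X e * Y e = 1) :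
    X w * Y w = -1 := by
  obtain ⟨x, hx⟩ := (hp.orthogonal X hX Y hY).1 ⟨e, he⟩
  rcases Finset.mem_insert.1 (hp.mem_of_mul_ne_zero hs hX hXD hYC (x := x) (by rw [hx]; decide))
    with rfl | hxF
  exacts [hx, absurd hx (sign_ne_neg_one_of_nonneg (hXY x hxF))]

theorem mul_nonneg_of_le_min {X Y : α → SignType} (hX : ∀ x ∈ F, 0 ≤ X x ∧ (x < a → X x = 0))
    (hY : ∀ x ∈ F, a ≤ x → 0 ≤ Y x) : ∀ x ∈ F, 0 ≤ X x * Y x := by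
  intro x hx
  rcases lt_or_ge x a with hxa | hxa
  · simp [(hX x hx).2 hxa]
  · exact sign_mul_nonneg (hX x hx).1 (hY x hx hxa)

end Minima

section Dichotomy

variable [LinearOrder α] {E F : Finset α} {V W : Set (α → SignType)} {C D : Set α} {a b w : α}

theorem DualPair.hasMin_insert_of_opposite_signs (hp : DualPair E V W)
    (hs : MinorSplit E (insert w F) C D) (hw : w ∉ F) {s : SignType} (ha : a ∈ F) (hab : a ≤ b)
    (h : HasMin (withSign V w s) F D a) (h' : HasMin (withSign V w (-s)) F D b) :
    HasMin V F (insert w D) a := by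
  by_contra hcon
  obtain ⟨Y, hY, hYa, hYC, hYF⟩ := hp.exists_of_not_hasMin (hs.delete hw) ha hcon
  obtain ⟨X, ⟨hX, hXw⟩, hXa, hXD, hXF⟩ := h
  obtain ⟨X', ⟨hX', hX'w⟩, -, hX'D, hX'F⟩ := h'
  have hw₁ : X w * Y w = -1 := hp.mul_eq_neg_one_of_nonneg hs hX hY hXD hYC
    (mul_nonneg_of_le_min hXF hYF) (e := a) (by rw [hXa, hYa]; decide)
  have hw₂ : X' w * Y w = -1 := hp.mul_eq_neg_one_of_nonneg hs hX' hY hX'D hYC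
    (mul_nonneg_of_le_min (fun x hx => ⟨(hX'F x hx).1, fun h => (hX'F x hx).2 (h.trans_le hab)⟩)
      hYF) (e := w) (by rw [hX'w, neg_mul, ← hXw, hw₁, neg_neg])
  rw [hX'w, neg_mul, ← hXw, hw₁] at hw₂
  exact absurd hw₂ (by decide)

theorem DualPair.minima_withSign_subset_or (hp : DualPair E V W)
    (hs : MinorSplit E (insert w F) C D) (hw : w ∉ F) :
    minima (withSign V w 1) F D ⊆ minima (withSign V w 0) F D ∨
      minima (withSign V w (-1)) F D ⊆ minima (withSign V w 0) F D := by
  rw [← minima_insert_eq_withSign_zero]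
  by_contra! hcon
  obtain ⟨⟨a, ha, hna⟩, b, hb, hnb⟩ := hcon.imp Finset.not_subset.1 Finset.not_subset.1
  obtain ⟨haF, ha⟩ := mem_minima.1 ha
  obtain ⟨hbF, hb⟩ := mem_minima.1 hb
  rcases le_total a b with hab | hab
  · exact hna (mem_minima.2 ⟨haF, hp.hasMin_insert_of_opposite_signs hs hw haF hab ha hb⟩)
  · refine hnb (mem_minima.2 ⟨hbF, hp.hasMin_insert_of_opposite_signs hs hw hbF hab hb ?_⟩)
    rwa [neg_neg]

theorem DualPair.minima_withSign_eq_empty_or (hp : DualPair E V W)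
    (hs : MinorSplit E (insert w F) C D) {s : SignType} (h0 : s ≠ 0) :
    minima (withSign V w s) F D = ∅ ∨ minima (withSign W w s) F C = ∅ := by
  have sq : ∀ s : SignType, s ≠ 0 → s * s = 1 := by decide
  by_contra! hcon
  obtain ⟨⟨a, ha⟩, b, hb⟩ := hcon
  obtain ⟨-, X, ⟨hX, hXw⟩, -, hXD, hXF⟩ := mem_minima.1 ha
  obtain ⟨-, Y, ⟨hY, hYw⟩, -, hYC, hYF⟩ := mem_minima.1 hb
  have hpos : X w * Y w = 1 := by rw [hXw, hYw, sq s h0]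
  have hneg : X w * Y w = -1 := hp.mul_eq_neg_one_of_nonneg hs hX hY hXD hYC
    (fun x hx => sign_mul_nonneg (hXF x hx).1 (hYF x hx).1) hpos
  exact absurd (hpos.symm.trans hneg) (by decide)

theorem DualPair.minima_withSign_dichotomy (hp : DualPair E V W)
    (hs : MinorSplit E (insert w F) C D) (hw : w ∉ F) :
    (minima (withSign V w 1) F D ⊆ minima (withSign V w 0) F D ∧
      minima (withSign W w (-1)) F C ⊆ minima (withSign W w 0) F C) ∨
    (minima (withSign V w (-1)) F D ⊆ minima (withSign V w 0) F D ∧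
      minima (withSign W w 1) F C ⊆ minima (withSign W w 0) F C) := by
  have subset : ∀ {S T : Finset α}, S = ∅ → S ⊆ T := fun h => h ▸ Finset.empty_subset _
  rcases hp.minima_withSign_subset_or hs hw, hp.symm.minima_withSign_subset_or hs.symm hw with
    ⟨hV | hV, hW | hW⟩
  · exact (hp.minima_withSign_eq_empty_or hs (s := -1) (by decide)).symm.imp
      (fun h => ⟨hV, subset h⟩) (fun h => ⟨subset h, hW⟩)
  · exact Or.inl ⟨hV, hW⟩
  · exact Or.inr ⟨hV, hW⟩
  · exact (hp.minima_withSign_eq_empty_or hs (s := 1) (by decide)).imp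
      (fun h => ⟨subset h, hW⟩) (fun h => ⟨hV, subset h⟩)

theorem erase_minima_of_subset_neg (hw : ∀ x ∈ F, x < w)
    (h : minima (withSign V w (-1)) F D ⊆ minima (withSign V w 0) F D) :
    (minima (flip {w} ⁻¹' V) (insert w F) D).erase w = minima V F (insert w D) ∧
      (minima V (insert w F) D).erase w = minima V F D := by
  have hwF : w ∉ F := fun h => lt_irrefl w (hw w h)
  have := erase_minima_of_subset (V := flip {w} ⁻¹' V) (Z := D) hw (by
    rwa [minima_withSign_preimage_flip _ _ hwF, minima_withSign_preimage_flip _ _ hwF, neg_zero])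
  rwa [preimage_flip_preimage_flip, minima_preimage_flip _ _ hwF,
    minima_preimage_flip _ _ hwF] at this

theorem DualPair.minima_insert_eq_of_hasMin (hp : DualPair E V W)
    (hs : MinorSplit E (insert w F) C D) (hw : ∀ x ∈ F, x < w)
    (h : HasMin V (insert w F) D w) :
    minima V F (insert w D) = minima V F D ∧ minima W F (insert w C) = minima W F C := by
  have hwF : w ∉ F := fun h => lt_irrefl w (hw w h)
  obtain ⟨L, hL, hLw, hLD, hLF⟩ := (hasMin_insert_self hw).1 h
  have hYw : ∀ Y ∈ W, (∀ x ∈ C, Y x = 0) → Y w = 0 := fun Y hY hYC => by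
    by_contra hYw
    have at_w : ∀ {x s}, s ≠ 0 → L x * Y x = s → L w * Y w = s := fun {x s} hs0 hx => by
      rcases Finset.mem_insert.1
        (hp.mem_of_mul_ne_zero hs hL hLD hYC (x := x) (hx.trans_ne hs0)) with rfl | hxF
      exacts [hx, absurd (hx.symm.trans (by rw [hLF x hxF, zero_mul])) hs0]
    have hLw0 : L w ≠ 0 := by rw [hLw]; decide
    obtain ⟨x, hx⟩ := (hp.orthogonal L hL Y hY).exists_mul_eq_one hLw0 hYw
    obtain ⟨y, hy⟩ := (hp.orthogonal L hL Y hY).exists_mul_eq_neg_one hLw0 hYw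
    exact absurd ((at_w (by decide) hx).symm.trans (at_w (by decide) hy)) (by decide)
  refine ⟨(minima_insert_subset ..).antisymm fun a ha => ?_,
    (minima_insert_subset ..).antisymm fun a ha => ?_⟩ <;> obtain ⟨haF, X, hX, hXa, hX0, hXF⟩ :=
      mem_minima.1 ha
  · refine mem_minima.2 ⟨haF, by_contra fun hcon => ?_⟩
    obtain ⟨Y, hY, hYa, hYC, hYF⟩ := hp.exists_of_not_hasMin (hs.delete hwF) haF hcon
    have := hp.mul_eq_neg_one_of_nonneg hs hX hY hX0 hYC (mul_nonneg_of_le_min hXF hYF) (e := a)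
      (by rw [hXa, hYa]; decide)
    rw [hYw Y hY hYC, mul_zero] at this
    exact absurd this (by decide)
  · exact mem_minima.2 ⟨haF, X, hX, hXa, Set.forall_mem_insert.2 ⟨hYw X hX hX0, hX0⟩, hXF⟩

end Dichotomy

section MinorActivities

variable [LinearOrder α] (M : OrientedMatroid α) {F : Finset α} {C D : Set α} {w : α}

/-- The active and the dual-active elements of the minor `M / C \ D` with ground set `F`. -/
noncomputable def minorActivities (F : Finset α) (C D : Set α) : Finset α × Finset α :=
  (minima M.circuits F D, minima M.cocircuits F C)

variable {M}

theorem minorActivities_reorient_singleton (hw : w ∉ F) :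
    (M.reorient {w}).minorActivities F C D = M.minorActivities F C D := by
  rw [minorActivities, circuits_reorient, cocircuits_reorient, minima_preimage_flip _ _ hw,
    minima_preimage_flip _ _ hw, minorActivities]

theorem mem_minorActivities_fst_iff (hs : MinorSplit M.E (insert w F) C D)
    (hw : ∀ x ∈ F, x < w) :
    w ∈ (M.minorActivities (insert w F) C D).1 ↔ w ∈ M.toMatroid.closure C := by
  rw [minorActivities, mem_minima, hasMin_insert_self hw,
    and_iff_right (Finset.mem_insert_self w F)]
  have hnotMem := (hs.contract fun h => lt_irrefl w (hw w h)).disjoint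
  rw [Set.disjoint_insert_left] at hnotMem
  constructor
  · rintro ⟨X, hX, hXw, hXD, hXF⟩
    have hXC : support X \ {w} ⊆ C := fun x ⟨hx, hxw⟩ => by
      rcases hs.cover x (M.support_subset X hX hx) with h | h | h
      · exact absurd (hXF x (Finset.mem_of_mem_insert_of_ne h hxw)) hx
      · exact h
      · exact absurd (hXD x h) hx
    exact M.toMatroid.closure_subset_closure hXC
      ((isCircuit_support hX).mem_closure_sdiff_singleton_of_mem (by simp [hXw]))
  · intro h
    have hwC : w ∉ C := Set.disjoint_left.1 hs.disjoint_contracted (by simp)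
    obtain ⟨X, hX, hXw, hXC⟩ := M.exists_circuit_of_mem_closure hwC h
    refine ⟨X, hX, hXw, fun x hx => ?_, fun x hx => ?_⟩ <;> by_contra hXx <;>
      rcases hXC hXx with rfl | hxC
    · exact hnotMem.1 hx
    · exact Set.disjoint_left.1 hs.disjoint hxC hx
    · exact lt_irrefl x (hw x hx)
    · exact Set.disjoint_left.1 hs.disjoint_contracted (by simp [hx]) hxC

theorem mem_minorActivities_snd_iff (hs : MinorSplit M.E (insert w F) C D)
    (hw : ∀ x ∈ F, x < w) :
    w ∈ (M.minorActivities (insert w F) C D).2 ↔ w ∉ M.toMatroid.closure (↑F ∪ C) := by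
  rw [minorActivities, mem_minima, hasMin_insert_self hw,
    and_iff_right (Finset.mem_insert_self w F)]
  constructor
  · rintro ⟨Y, hY, hYw, hYC, hYF⟩ h
    have hwF : w ∉ F := fun h => lt_irrefl w (hw w h)
    have hwC : w ∉ C := Set.disjoint_left.1 hs.disjoint_contracted (by simp)
    obtain ⟨X, hX, hXw, hXs⟩ := M.exists_circuit_of_mem_closure (by simp [hwF, hwC]) h
    obtain ⟨x, hx⟩ := (hY.2 X hX).1 ⟨w, by rw [hXw, hYw]; decide⟩
    have hx0 : X x * Y x ≠ 0 := by rw [hx]; decide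
    rcases hXs (left_ne_zero_of_mul hx0) with rfl | hxF | hxC
    · rw [hXw, hYw] at hx
      exact absurd hx (by decide)
    · exact right_ne_zero_of_mul hx0 (hYF x hxF)
    · exact right_ne_zero_of_mul hx0 (hYC x hxC)
  · intro h
    obtain ⟨Y, hY, hYw, hY0⟩ :=
      M.exists_cocircuit_of_notMem_closure (hs.subset (Finset.mem_insert_self w F)) h
    exact ⟨Y, hY, hYw, fun x hx => hY0 x (Or.inr hx), fun x hx => hY0 x (Or.inl hx)⟩

theorem erase_minorActivities_dichotomy (hs : MinorSplit M.E (insert w F) C D)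
    (hw : ∀ x ∈ F, x < w) :
    ((M.minorActivities (insert w F) C D).map (·.erase w) (·.erase w) =
        M.minorActivities F C (insert w D) ∧
      ((M.reorient {w}).minorActivities (insert w F) C D).map (·.erase w) (·.erase w) =
        M.minorActivities F (insert w C) D) ∨
    (((M.reorient {w}).minorActivities (insert w F) C D).map (·.erase w) (·.erase w) =
        M.minorActivities F C (insert w D) ∧
      (M.minorActivities (insert w F) C D).map (·.erase w) (·.erase w) =
        M.minorActivities F (insert w C) D) := by
  simp only [minorActivities, Prod.map, Prod.mk.injEq, circuits_reorient, cocircuits_reorient]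
  rcases M.dualPair.minima_withSign_dichotomy hs fun h => lt_irrefl w (hw w h) with
    ⟨hV, hW⟩ | ⟨hV, hW⟩
  · obtain ⟨hVdel, hVcon⟩ := erase_minima_of_subset hw hV
    obtain ⟨hWcon, hWdel⟩ := erase_minima_of_subset_neg hw hW
    exact Or.inl ⟨⟨hVdel, hWdel⟩, hVcon, hWcon⟩
  · obtain ⟨hVdel, hVcon⟩ := erase_minima_of_subset_neg hw hV
    obtain ⟨hWcon, hWdel⟩ := erase_minima_of_subset hw hW
    exact Or.inr ⟨⟨hVdel, hWdel⟩, hVcon, hWcon⟩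

theorem erase_minorActivities_of_delete_eq_contract (hs : MinorSplit M.E (insert w F) C D)
    (hw : ∀ x ∈ F, x < w)
    (h : M.minorActivities F C (insert w D) = M.minorActivities F (insert w C) D) :
    (M.minorActivities (insert w F) C D).map (·.erase w) (·.erase w) =
      M.minorActivities F C (insert w D) :=
  (erase_minorActivities_dichotomy hs hw).elim And.left fun h' => h'.2.trans h.symm

theorem minorActivities_insert_loop (hs : MinorSplit M.E (insert w F) C D)
    (hw : ∀ x ∈ F, x < w) (hloop : w ∈ M.toMatroid.closure C) :
    M.minorActivities (insert w F) C D =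
      (insert w (M.minorActivities F C (insert w D)).1,
        (M.minorActivities F C (insert w D)).2) := by
  have hfst := (mem_minorActivities_fst_iff hs hw).2 hloop
  have hsnd := mt (mem_minorActivities_snd_iff hs hw).1
    (not_not_intro (M.toMatroid.closure_subset_closure Set.subset_union_right hloop))
  obtain ⟨hV, hW⟩ := M.dualPair.minima_insert_eq_of_hasMin hs hw (mem_minima.1 hfst).2
  rw [← erase_minorActivities_of_delete_eq_contract hs hw (Prod.ext hV hW.symm)]
  exact Prod.ext (Finset.insert_erase hfst).symm (Finset.erase_eq_of_notMem hsnd).symm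

theorem minorActivities_insert_coloop (hs : MinorSplit M.E (insert w F) C D)
    (hw : ∀ x ∈ F, x < w) (hcoloop : w ∉ M.toMatroid.closure (↑F ∪ C)) :
    M.minorActivities (insert w F) C D =
      ((M.minorActivities F C (insert w D)).1,
        insert w (M.minorActivities F C (insert w D)).2) := by
  have hsnd := (mem_minorActivities_snd_iff hs hw).2 hcoloop
  have hfst := mt (mem_minorActivities_fst_iff hs hw).1
    fun h => hcoloop (M.toMatroid.closure_subset_closure Set.subset_union_right h)
  obtain ⟨hW, hV⟩ := M.dualPair.symm.minima_insert_eq_of_hasMin hs.symm hw (mem_minima.1 hsnd).2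
  rw [← erase_minorActivities_of_delete_eq_contract hs hw (Prod.ext hV hW.symm)]
  exact Prod.ext (Finset.erase_eq_of_notMem hfst).symm (Finset.insert_erase hsnd).symm

theorem minorActivities_dichotomy (hs : MinorSplit M.E (insert w F) C D) (hw : ∀ x ∈ F, x < w)
    (hloop : w ∉ M.toMatroid.closure C) (hcoloop : w ∈ M.toMatroid.closure (↑F ∪ C)) :
    (M.minorActivities (insert w F) C D = M.minorActivities F C (insert w D) ∧
      (M.reorient {w}).minorActivities (insert w F) C D = M.minorActivities F (insert w C) D) ∨
    ((M.reorient {w}).minorActivities (insert w F) C D = M.minorActivities F C (insert w D) ∧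
      M.minorActivities (insert w F) C D = M.minorActivities F (insert w C) D) := by
  have erase_eq : ∀ {N : OrientedMatroid α}, MinorSplit N.E (insert w F) C D →
      N.toMatroid = M.toMatroid →
      (N.minorActivities (insert w F) C D).map (·.erase w) (·.erase w) =
        N.minorActivities (insert w F) C D := fun {N} hs hN =>
    Prod.ext
      (Finset.erase_eq_of_notMem (mt (mem_minorActivities_fst_iff hs hw).1 (hN ▸ hloop)))
      (Finset.erase_eq_of_notMem
        (mt (mem_minorActivities_snd_iff hs hw).1 (not_not_intro (hN ▸ hcoloop))))
  have := erase_minorActivities_dichotomy hs hw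
  rwa [erase_eq hs rfl, erase_eq (N := M.reorient {w}) hs (M.reorient_toMatroid {w})] at this

end MinorActivities

section ActivityMonomial

variable [DecidableEq α] {R : Type*} [CommRing R] (x u y v : R) {A O P : Finset α} {w : α}

/-- The monomial of a reorientation `A` with active elements `O` and dual-active elements `P`: the
variables `x` and `u` count the dual-active elements outside and in `A`, the variables `y` and `v`
the active ones. -/
def activityMonomial (A : Finset α) (OP : Finset α × Finset α) : R :=
  x ^ (OP.2 \ A).card * u ^ (OP.2 ∩ A).card * (y ^ (OP.1 \ A).card * v ^ (OP.1 ∩ A).card)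

theorem activityMonomial_insert (hO : w ∉ O) (hP : w ∉ P) :
    activityMonomial x u y v (insert w A) (O, P) = activityMonomial x u y v A (O, P) := by
  simp only [activityMonomial, Finset.sdiff_insert_of_notMem hO, Finset.sdiff_insert_of_notMem hP,
    Finset.inter_insert_of_notMem hO, Finset.inter_insert_of_notMem hP]

theorem activityMonomial_swap :
    activityMonomial x u y v A (O, P) = activityMonomial y v x u A (P, O) :=
  mul_comm ..

theorem activityMonomial_insert_active (hA : w ∉ A) (hO : w ∉ O) (hP : w ∉ P) :
    activityMonomial x u y v A (insert w O, P) +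
        activityMonomial x u y v (insert w A) (insert w O, P) =
      (y + v) * activityMonomial x u y v A (O, P) := by
  have hO' : insert w O \ insert w A = O \ A := by
    rw [Finset.insert_sdiff_of_mem _ (Finset.mem_insert_self w A),
      Finset.sdiff_insert_of_notMem hO]
  have hOA : insert w O ∩ insert w A = insert w (O ∩ A) := (Finset.insert_inter_distrib ..).symm
  simp only [activityMonomial, hO', hOA, Finset.sdiff_insert_of_notMem hP,
    Finset.inter_insert_of_notMem hP, Finset.insert_sdiff_of_notMem _ hA,
    Finset.insert_inter_of_notMem hA]
  rw [Finset.card_insert_of_notMem (by simp [hO]), Finset.card_insert_of_notMem (by simp [hO])]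
  ring

theorem activityMonomial_insert_dualActive (hA : w ∉ A) (hO : w ∉ O) (hP : w ∉ P) :
    activityMonomial x u y v A (O, insert w P) +
        activityMonomial x u y v (insert w A) (O, insert w P) =
      (x + u) * activityMonomial x u y v A (O, P) := by
  simp only [activityMonomial_swap x u y v]
  exact activityMonomial_insert_active y v x u hA hP hO

end ActivityMonomial

/-! ### The Tutte polynomial -/

section Rank

variable (M : OrientedMatroid α)

/-- The rank function of the underlying matroid. -/
noncomputable def rk (S : Set α) : ℕ := (M.toMatroid.eRk S).toNat

instance : M.toMatroid.Finite := ⟨M.E.finite_toSet⟩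

theorem eRk_ne_top (S : Set α) : M.toMatroid.eRk S ≠ ⊤ :=
  Matroid.eRk_ne_top_iff.2 (M.toMatroid.isRkFinite_set S)

theorem rk_insert_of_mem_closure {S : Set α} {e : α} (he : e ∈ M.toMatroid.closure S) :
    M.rk (insert e S) = M.rk S := by
  unfold rk
  rw [← Matroid.eRk_closure_eq, Matroid.closure_insert_eq_of_mem_closure he,
    Matroid.eRk_closure_eq]

theorem rk_insert_of_notMem_closure {S : Set α} {e : α} (heE : e ∈ M.E)
    (he : e ∉ M.toMatroid.closure S) : M.rk (insert e S) = M.rk S + 1 := by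
  unfold rk
  rw [Matroid.eRk_insert_eq_add_one ⟨heE, he⟩, ENat.toNat_add (M.eRk_ne_top S) (by simp)]
  rfl

theorem rk_mono {S T : Set α} (h : S ⊆ T) : M.rk S ≤ M.rk T :=
  ENat.toNat_le_toNat (M.toMatroid.eRk_mono h) (M.eRk_ne_top T)

theorem rk_union_le (A : Finset α) (C : Set α) : M.rk (↑A ∪ C) ≤ A.card + M.rk C := by
  have h := ENat.toNat_le_toNat (M.toMatroid.eRk_union_le_encard_add_eRk A C)
    (by simp [M.eRk_ne_top])
  rwa [ENat.toNat_add (by simp) (M.eRk_ne_top C), Set.encard_coe_eq_coe_finsetCard,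
    ENat.toNat_natCast] at h

end Rank

section MinorTutte

variable (M : OrientedMatroid α) {R : Type*} [CommRing R] (x y : R)

/-- The value at `(x, y)` of the Tutte polynomial of the minor with ground set `F` obtained by
contracting `C` and deleting all other elements. -/
noncomputable def minorTutte (F : Finset α) (C : Set α) : R :=
  ∑ A ∈ F.powerset, (x - 1) ^ (M.rk (↑F ∪ C) - M.rk (↑A ∪ C)) *
    (y - 1) ^ (A.card + M.rk C - M.rk (↑A ∪ C))

theorem minorTutte_ground : M.minorTutte (MvPolynomial.X 0) (MvPolynomial.X 1) M.E ∅ = M.tutte :=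
  Finset.sum_congr rfl fun A _ => by simp [rk]

theorem tutteEval_eq_minorTutte (a b : ℤ) : M.tutteEval a b = M.minorTutte a b M.E ∅ := by
  simp [tutteEval, ← minorTutte_ground, minorTutte]

variable {M} [DecidableEq α] {F : Finset α} {C : Set α} {w : α}

theorem minorTutte_insert_loop (hwF : w ∉ F) (hw : w ∈ M.toMatroid.closure C) :
    M.minorTutte x y (insert w F) C = y * M.minorTutte x y F C := by
  unfold minorTutte
  rw [Finset.sum_powerset_insert hwF, Finset.mul_sum, ← Finset.sum_add_distrib]
  have rank_insert : ∀ A : Finset α, M.rk (↑(insert w A) ∪ C) = M.rk (↑A ∪ C) := fun A => by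
    rw [Finset.coe_insert, Set.insert_union]
    exact M.rk_insert_of_mem_closure (M.toMatroid.closure_subset_closure Set.subset_union_right hw)
  refine Finset.sum_congr rfl fun A hA => ?_
  have hwA : w ∉ A := fun h => hwF (Finset.mem_powerset.1 hA h)
  have := M.rk_union_le A C
  rw [rank_insert, rank_insert, Finset.card_insert_of_notMem hwA,
    show A.card + 1 + M.rk C - M.rk (↑A ∪ C) = A.card + M.rk C - M.rk (↑A ∪ C) + 1 by omega]
  ring

theorem minorTutte_insert_coloop (hwF : w ∉ F) (hwE : w ∈ M.E)
    (hw : w ∉ M.toMatroid.closure (↑F ∪ C)) :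
    M.minorTutte x y (insert w F) C = x * M.minorTutte x y F C := by
  unfold minorTutte
  rw [Finset.sum_powerset_insert hwF, Finset.mul_sum, ← Finset.sum_add_distrib]
  have rank_insert : ∀ A : Finset α, A ⊆ F → M.rk (↑(insert w A) ∪ C) = M.rk (↑A ∪ C) + 1 := by
    intro A hA
    rw [Finset.coe_insert, Set.insert_union]
    exact M.rk_insert_of_notMem_closure hwE fun h => hw (M.toMatroid.closure_subset_closure
      (Set.union_subset_union_left _ (Finset.coe_subset.2 hA)) h)
  refine Finset.sum_congr rfl fun A hA => ?_
  have hAF := Finset.mem_powerset.1 hA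
  have hwA : w ∉ A := fun h => hwF (hAF h)
  have := M.rk_union_le A C
  have : M.rk (↑A ∪ C) ≤ M.rk (↑F ∪ C) :=
    M.rk_mono (Set.union_subset_union_left _ (Finset.coe_subset.2 hAF))
  rw [rank_insert A hAF, rank_insert F subset_rfl, Finset.card_insert_of_notMem hwA,
    show A.card + 1 + M.rk C - (M.rk (↑A ∪ C) + 1) = A.card + M.rk C - M.rk (↑A ∪ C) by omega,
    show M.rk (↑F ∪ C) + 1 - M.rk (↑A ∪ C) = M.rk (↑F ∪ C) - M.rk (↑A ∪ C) + 1 by omega,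
    Nat.add_sub_add_right]
  ring

theorem minorTutte_insert (hwF : w ∉ F) (hwE : w ∈ M.E) (hw : w ∈ M.toMatroid.closure (↑F ∪ C))
    (hw' : w ∉ M.toMatroid.closure C) :
    M.minorTutte x y (insert w F) C =
      M.minorTutte x y F C + M.minorTutte x y F (insert w C) := by
  unfold minorTutte
  rw [Finset.sum_powerset_insert hwF]
  have rank_ground : M.rk (insert w (↑F ∪ C)) = M.rk (↑F ∪ C) := M.rk_insert_of_mem_closure hw
  have rank_contracted : M.rk (insert w C) = M.rk C + 1 := M.rk_insert_of_notMem_closure hwE hw'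
  congr 1
  · rw [Finset.coe_insert, Set.insert_union, rank_ground]
  · refine Finset.sum_congr rfl fun A hA => ?_
    have hwA : w ∉ A := fun h => hwF (Finset.mem_powerset.1 hA h)
    rw [Finset.coe_insert, Finset.coe_insert, Set.insert_union, Set.insert_union,
      Set.union_insert, Set.union_insert, rank_contracted,
      Finset.card_insert_of_notMem hwA]
    congr 2
    omega

end MinorTutte

section Expansion

variable [LinearOrder α] {M : OrientedMatroid α} {R : Type*} [CommRing R] (x u y v : R)
  {F A : Finset α} {C D : Set α} {w : α}

theorem activityMonomial_add_of_loop (hs : MinorSplit M.E (insert w F) C D)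
    (hw : ∀ x ∈ F, x < w) (hA : w ∉ A) (hloop : w ∈ M.toMatroid.closure C) :
    activityMonomial x u y v A (M.minorActivities (insert w F) C D) +
        activityMonomial x u y v (insert w A) ((M.reorient {w}).minorActivities (insert w F) C D) =
      (y + v) * activityMonomial x u y v A (M.minorActivities F C (insert w D)) := by
  have hwF : w ∉ F := fun h => lt_irrefl w (hw w h)
  rw [minorActivities_insert_loop hs hw hloop,
    minorActivities_insert_loop (M := M.reorient {w}) hs hw (by rwa [reorient_toMatroid]),
    minorActivities_reorient_singleton hwF]
  exact activityMonomial_insert_active x u y v hA (Finset.notMem_mono (minima_subset _ _ _) hwF)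
    (Finset.notMem_mono (minima_subset _ _ _) hwF)

theorem activityMonomial_add_of_coloop (hs : MinorSplit M.E (insert w F) C D)
    (hw : ∀ x ∈ F, x < w) (hA : w ∉ A) (hcoloop : w ∉ M.toMatroid.closure (↑F ∪ C)) :
    activityMonomial x u y v A (M.minorActivities (insert w F) C D) +
        activityMonomial x u y v (insert w A) ((M.reorient {w}).minorActivities (insert w F) C D) =
      (x + u) * activityMonomial x u y v A (M.minorActivities F C (insert w D)) := by
  have hwF : w ∉ F := fun h => lt_irrefl w (hw w h)
  rw [minorActivities_insert_coloop hs hw hcoloop,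
    minorActivities_insert_coloop (M := M.reorient {w}) hs hw (by rwa [reorient_toMatroid]),
    minorActivities_reorient_singleton hwF]
  exact activityMonomial_insert_dualActive x u y v hA (Finset.notMem_mono (minima_subset _ _ _) hwF)
    (Finset.notMem_mono (minima_subset _ _ _) hwF)

theorem activityMonomial_add (hs : MinorSplit M.E (insert w F) C D) (hw : ∀ x ∈ F, x < w)
    (hloop : w ∉ M.toMatroid.closure C) (hcoloop : w ∈ M.toMatroid.closure (↑F ∪ C)) :
    activityMonomial x u y v A (M.minorActivities (insert w F) C D) +
        activityMonomial x u y v (insert w A) ((M.reorient {w}).minorActivities (insert w F) C D) =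
      activityMonomial x u y v A (M.minorActivities F C (insert w D)) +
        activityMonomial x u y v A (M.minorActivities F (insert w C) D) := by
  have hwF : w ∉ F := fun h => lt_irrefl w (hw w h)
  have drop : ∀ C D, activityMonomial x u y v (insert w A) (M.minorActivities F C D) =
      activityMonomial x u y v A (M.minorActivities F C D) := fun C D =>
    activityMonomial_insert x u y v (Finset.notMem_mono (minima_subset _ _ _) hwF)
      (Finset.notMem_mono (minima_subset _ _ _) hwF)
  rcases minorActivities_dichotomy hs hw hloop hcoloop with ⟨h, h'⟩ | ⟨h, h'⟩
  · rw [h, h', drop]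
  · rw [h, h', drop, add_comm]

variable (M)

theorem sum_activityMonomial (F : Finset α) : ∀ C D : Set α, MinorSplit M.E F C D →
    ∑ A ∈ F.powerset, activityMonomial x u y v A ((M.reorient A).minorActivities F C D) =
      M.minorTutte (x + u) (y + v) F C := by
  induction F using Finset.induction_on_max with
  | empty => intro C D _; simp [minorTutte, minorActivities, minima, activityMonomial]
  | insert w F hw ih =>
    intro C D hs
    have hwF : w ∉ F := fun h => lt_irrefl w (hw w h)
    have hwE : w ∈ M.E := hs.subset (Finset.mem_insert_self w F)
    have hwA : ∀ {A}, A ∈ F.powerset → w ∉ A := fun hA =>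
      Finset.notMem_mono (Finset.mem_powerset.1 hA) hwF
    have reorient_insert : ∀ A ∈ F.powerset,
        M.reorient (insert w A) = (M.reorient A).reorient {w} := fun A hA => by
      rw [reorient_reorient, (Finset.disjoint_singleton_right.2 (hwA hA)).symmDiff_eq_sup,
        Finset.sup_eq_union, Finset.union_comm, Finset.insert_eq]
    rw [Finset.sum_powerset_insert hwF, ← Finset.sum_add_distrib,
      Finset.sum_congr rfl fun A hA => by rw [reorient_insert A hA]]
    by_cases hloop : w ∈ M.toMatroid.closure C
    · rw [minorTutte_insert_loop _ _ hwF hloop, ← ih C (insert w D) (hs.delete hwF), Finset.mul_sum]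
      exact Finset.sum_congr rfl fun A hA => activityMonomial_add_of_loop x u y v
        (M := M.reorient A) hs hw (hwA hA) (by rwa [reorient_toMatroid])
    by_cases hcoloop : w ∈ M.toMatroid.closure (↑F ∪ C)
    · rw [minorTutte_insert _ _ hwF hwE hcoloop hloop, ← ih C (insert w D) (hs.delete hwF),
        ← ih (insert w C) D (hs.contract hwF), ← Finset.sum_add_distrib]
      exact Finset.sum_congr rfl fun A _ => activityMonomial_add x u y v
        (M := M.reorient A) hs hw (by rwa [reorient_toMatroid]) (by rwa [reorient_toMatroid])
    · rw [minorTutte_insert_coloop _ _ hwF hwE hcoloop, ← ih C (insert w D) (hs.delete hwF),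
        Finset.mul_sum]
      exact Finset.sum_congr rfl fun A hA => activityMonomial_add_of_coloop x u y v
        (M := M.reorient A) hs hw (hwA hA) (by rwa [reorient_toMatroid])

end Expansion

/-! ### Active elements -/

section PosUnion

/-- The union of the supports of the nonnegative vectors of `V` that vanish on `L`. -/
def posUnion (V : Set (α → SignType)) (L : Set α) : Set α :=
  {x | ∃ X ∈ V, (∀ z, 0 ≤ X z) ∧ (∀ z ∈ L, X z = 0) ∧ X x ≠ 0}

variable {E : Finset α} {V W : Set (α → SignType)} {L : Set α} {a x : α}

theorem posUnion_anti (V : Set (α → SignType)) : Antitone (posUnion V) :=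
  fun _ _ h _ ⟨X, hX, hX0, hXL, hx⟩ => ⟨X, hX, hX0, fun z hz => hXL z (h hz), hx⟩

theorem notMem_of_mem_posUnion (hx : x ∈ posUnion V L) : x ∉ L :=
  fun hxL => let ⟨_, _, _, hXL, hXx⟩ := hx; hXx (hXL x hxL)

theorem DualPair.posUnion_subset (hp : DualPair E V W) : posUnion V L ⊆ E :=
  fun _ ⟨X, hX, _, _, hXx⟩ => hp.support_left X hX hXx

theorem DualPair.eq_zero_of_mem_posUnion (hp : DualPair E V W) (hx : x ∈ posUnion V L)
    {Y : α → SignType} (hY : Y ∈ W) (hYL : ∀ z ∉ L, 0 ≤ Y z) : Y x = 0 := by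
  obtain ⟨X, hX, hX0, hXL, hXx⟩ := hx
  by_contra hYx
  obtain ⟨z, hz⟩ := (hp.orthogonal X hX Y hY).exists_mul_eq_neg_one hXx hYx
  exact sign_ne_neg_one_of_nonneg
    (sign_mul_nonneg (hX0 z) (hYL z fun hzL => by simp [hXL z hzL] at hz)) hz

theorem DualPair.mem_posUnion_iff (hp : DualPair E V W) (hx : x ∈ E) (hxL : x ∉ L) :
    x ∈ posUnion V L ↔ ∀ Y ∈ W, (∀ z ∉ L, 0 ≤ Y z) → Y x = 0 := by
  refine ⟨fun h Y => hp.eq_zero_of_mem_posUnion h, fun h => ?_⟩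
  rcases hp.painting x hx L ∅ hxL (Set.notMem_empty x) (Set.disjoint_empty L) with
    ⟨X, hX, hXx, hXL, hX0⟩ | ⟨Y, hY, hYx, -, hYL⟩
  · exact ⟨X, hX, fun z => hX0 z (Set.notMem_empty z), hXL, by rw [hXx]; decide⟩
  · exact absurd (hYx.symm.trans (h Y hY hYL)) (by decide)

theorem DualPair.disjoint_posUnion (hp : DualPair E V W) (L L' : Set α) :
    Disjoint (posUnion V L) (posUnion W L') :=
  Set.disjoint_left.2 fun _ hx ⟨_, hY, hY0, _, hYx⟩ =>
    hYx (hp.eq_zero_of_mem_posUnion hx hY fun z _ => hY0 z)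

variable [LinearOrder α]

theorem mem_posUnion_Iio_self_iff : a ∈ posUnion V (Set.Iio a) ↔
    ∃ X ∈ V, (∀ x, 0 ≤ X x) ∧ IsLeast (support X) a := by
  constructor
  · rintro ⟨X, hX, hX0, hXL, hXa⟩
    exact ⟨X, hX, hX0, hXa, fun x hx => not_lt.1 fun hxa => hx (hXL x hxa)⟩
  · rintro ⟨X, hX, hX0, hXa, hle⟩
    exact ⟨X, hX, hX0, fun x hxa => by_contra fun hx => (hle hx).not_gt hxa, hXa⟩

theorem exists_isLeast_support {X : α → SignType} (hX : support X ⊆ E)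
    (hX0 : (support X).Nonempty) : ∃ a, IsLeast (support X) a := by
  obtain ⟨a, ha, hmin⟩ := (E.finite_toSet.subset hX).exists_minimal hX0
  exact ⟨a, ha, fun x hx => (le_total a x).elim id (hmin hx)⟩

theorem mem_minima_ground_iff (hV : ∀ X ∈ V, support X ⊆ E) :
    a ∈ minima V E ∅ ↔ a ∈ posUnion V (Set.Iio a) := by
  have eq_zero : ∀ X ∈ V, ∀ x ∉ E, X x = 0 := fun X hX x hx =>
    Function.notMem_support.1 (mt (@hV X hX x) hx)
  rw [mem_minima]
  constructor
  · rintro ⟨-, X, hX, hXa, -, hXE⟩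
    refine ⟨X, hX, fun x => ?_, fun x hx => ?_, by rw [hXa]; decide⟩ <;> by_cases hxE : x ∈ E
    exacts [(hXE x hxE).1, (eq_zero X hX x hxE).ge, (hXE x hxE).2 hx, eq_zero X hX x hxE]
  · rintro ⟨X, hX, hX0, hXL, hXa⟩
    exact ⟨hV X hX hXa, X, hX, (sign_eq_one_or_neg_one hXa).resolve_right
      fun h => absurd (h ▸ hX0 a) (by decide), by simp, fun x _ => ⟨hX0 x, hXL x⟩⟩

end PosUnion

section Activities

variable [LinearOrder α] (M : OrientedMatroid α)

/-- The set of active elements, as a finite set. -/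
noncomputable def activeFinset : Finset α := (M.minorActivities M.E ∅ ∅).1

/-- The set of dual-active elements, as a finite set. -/
noncomputable def dualActiveFinset : Finset α := (M.minorActivities M.E ∅ ∅).2

variable {M} in
theorem mem_activeFinset_iff {a : α} :
    a ∈ M.activeFinset ↔ a ∈ posUnion M.circuits (Set.Iio a) :=
  mem_minima_ground_iff M.support_subset

variable {M} in
theorem mem_dualActiveFinset_iff {a : α} :
    a ∈ M.dualActiveFinset ↔ a ∈ posUnion M.cocircuits (Set.Iio a) :=
  mem_minima_ground_iff M.dualPair.support_right

theorem coe_activeFinset : (M.activeFinset : Set α) = M.activeElements := by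
  ext a
  rw [Finset.mem_coe, mem_activeFinset_iff, mem_posUnion_Iio_self_iff]
  simp [activeElements, posCircuits, and_assoc]

theorem coe_dualActiveFinset : (M.dualActiveFinset : Set α) = M.dualActiveElements := by
  ext a
  rw [Finset.mem_coe, mem_dualActiveFinset_iff, mem_posUnion_Iio_self_iff]
  simp [dualActiveElements, posCocircuits, and_assoc]

theorem card_activeFinset : M.activeFinset.card = M.activity := by
  rw [activity, ← coe_activeFinset, Set.ncard_coe_finset]

theorem card_dualActiveFinset : M.dualActiveFinset.card = M.dualActivity := by
  rw [dualActivity, ← coe_dualActiveFinset, Set.ncard_coe_finset]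

theorem disjoint_activeFinset_dualActiveFinset : Disjoint M.activeFinset M.dualActiveFinset :=
  Finset.disjoint_left.2 fun _ ha ha' => Set.disjoint_left.1 (M.dualPair.disjoint_posUnion _ _)
    (mem_activeFinset_iff.1 ha) (mem_dualActiveFinset_iff.1 ha')

variable {M}

theorem acyclic_iff : M.Acyclic ↔ M.activeFinset = ∅ := by
  rw [Acyclic, ← Finset.coe_eq_empty, coe_activeFinset, Set.eq_empty_iff_forall_notMem,
    Set.eq_empty_iff_forall_notMem]
  refine ⟨fun h a ⟨C, hC, _⟩ => h C hC, ?_⟩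
  rintro h _ ⟨X, hX, hX0, rfl⟩
  have hne : (support X).Nonempty :=
    Function.support_nonempty_iff.2 fun h => M.zero_notMem (h ▸ hX)
  obtain ⟨a, ha⟩ := exists_isLeast_support (M.support_subset X hX) hne
  exact h a ⟨_, ⟨X, hX, hX0, rfl⟩, ha⟩

theorem totallyCyclic_iff : M.TotallyCyclic ↔ M.dualActiveFinset = ∅ := by
  have mem_iff : ∀ e ∈ M.E, (∃ C ∈ M.posCircuits, e ∈ C) ↔
      ∀ Y ∈ M.cocircuits, (∀ x, 0 ≤ Y x) → Y e = 0 := fun e he => by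
    have := M.dualPair.mem_posUnion_iff he (Set.notMem_empty e)
    simpa [posUnion, posCircuits, and_assoc] using this
  rw [TotallyCyclic, ← Finset.coe_eq_empty, coe_dualActiveFinset, Set.eq_empty_iff_forall_notMem]
  constructor
  · rintro h a ⟨_, ⟨Y, hY, hY0, rfl⟩, ha, -⟩
    have haE : a ∈ M.E := M.dualPair.support_right Y hY ha
    exact ha ((mem_iff a haE).1 (h a haE) Y hY hY0)
  · refine fun h e he => (mem_iff e he).2 fun Y hY hY0 => ?_
    obtain ⟨a, ha⟩ := exists_isLeast_support (M.dualPair.support_right Y hY) hY.1.nonempty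
    exact absurd ⟨_, ⟨Y, hY, hY0, rfl⟩, ha⟩ (h a)

theorem activeFixed_iff {A : Finset α} :
    M.ActiveFixed A ↔ (M.reorient A).activeFinset ∩ A = ∅ := by
  rw [ActiveFixed, ← coe_activeFinset, ← Finset.coe_inter, Finset.coe_eq_empty]

theorem dualActiveFixed_iff {A : Finset α} :
    M.DualActiveFixed A ↔ (M.reorient A).dualActiveFinset ∩ A = ∅ := by
  rw [DualActiveFixed, ← coe_dualActiveFinset, ← Finset.coe_inter, Finset.coe_eq_empty]

theorem Acyclic.activeFixed {A : Finset α} (h : (M.reorient A).Acyclic) : M.ActiveFixed A := by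
  rw [activeFixed_iff, acyclic_iff.1 h, Finset.empty_inter]

theorem TotallyCyclic.dualActiveFixed {A : Finset α} (h : (M.reorient A).TotallyCyclic) :
    M.DualActiveFixed A := by
  rw [dualActiveFixed_iff, totallyCyclic_iff.1 h, Finset.empty_inter]

end Activities

section Enumeration

theorem natCast_ncard_subsets {R : Type*} [AddCommMonoidWithOne R] (E : Finset α)
    (p : Finset α → Prop) [DecidablePred p] :
    ({A : Finset α | A ⊆ E ∧ p A}.ncard : R) = ∑ A ∈ E.powerset, if p A then 1 else 0 := by
  have coe_filter : {A : Finset α | A ⊆ E ∧ p A} = ↑(E.powerset.filter p) := by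
    ext A
    simp
  rw [coe_filter, Set.ncard_coe_finset, Finset.sum_boole]

variable [LinearOrder α] (M : OrientedMatroid α)

theorem sum_activityMonomial_ground {R : Type*} [CommRing R] (x u y v : R) :
    ∑ A ∈ M.E.powerset, activityMonomial x u y v A
      ((M.reorient A).activeFinset, (M.reorient A).dualActiveFinset) =
        M.minorTutte (x + u) (y + v) M.E ∅ :=
  M.sum_activityMonomial x u y v M.E ∅ ∅ (MinorSplit.ground _)

open Classical in
theorem sum_fixed {R : Type*} [CommRing R] (x y : R) :
    (∑ A ∈ M.E.powerset, if M.ActiveFixed A ∧ M.DualActiveFixed A then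
      x ^ (M.reorient A).dualActivity * y ^ (M.reorient A).activity else 0) =
      M.minorTutte x y M.E ∅ := by
  rw [← add_zero x, ← add_zero y, ← sum_activityMonomial_ground, add_zero, add_zero]
  refine Finset.sum_congr rfl fun A _ => ?_
  simp only [activityMonomial, zero_pow_eq, Finset.card_eq_zero, ← activeFixed_iff,
    ← dualActiveFixed_iff, mul_ite, ite_mul, mul_one, mul_zero, zero_mul, ← ite_and]
  refine ite_congr rfl (fun h => ?_) fun _ => rfl
  rw [activeFixed_iff, dualActiveFixed_iff, ← Finset.disjoint_iff_inter_eq_empty,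
    ← Finset.disjoint_iff_inter_eq_empty] at h
  rw [h.1.sdiff_eq_left, h.2.sdiff_eq_left, card_activeFinset, card_dualActiveFinset]

theorem ncard_fixed_activities (i j : ℕ) :
    ({A : Finset α | A ⊆ M.E ∧ M.ActiveFixed A ∧ M.DualActiveFixed A ∧
      (M.reorient A).activity = i ∧ (M.reorient A).dualActivity = j}.ncard : ℤ) =
      M.tutteCoeff j i := by
  classical
  have single_inj : ∀ a b : ℕ, Finsupp.single (0 : Fin 2) a + Finsupp.single 1 b =
      Finsupp.single 0 j + Finsupp.single 1 i ↔ b = i ∧ a = j := fun a b =>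
    ⟨fun h => ⟨by simpa using DFunLike.congr_fun h 1, by simpa using DFunLike.congr_fun h 0⟩,
      fun h => by rw [h.1, h.2]⟩
  rw [natCast_ncard_subsets, tutteCoeff, ← minorTutte_ground, ← sum_fixed, MvPolynomial.coeff_sum]
  refine Finset.sum_congr rfl fun A _ => ?_
  simp only [MvPolynomial.X_pow_eq_monomial, MvPolynomial.monomial_mul, mul_one,
    apply_ite (MvPolynomial.coeff _), MvPolynomial.coeff_monomial, MvPolynomial.coeff_zero,
    single_inj, ← ite_and, and_assoc]

theorem ncard_fixed :
    ({A : Finset α | A ⊆ M.E ∧ M.ActiveFixed A ∧ M.DualActiveFixed A}.ncard : ℤ) =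
      M.tutteEval 1 1 := by
  classical
  simp only [natCast_ncard_subsets, tutteEval_eq_minorTutte, ← sum_fixed, one_pow, mul_one]

theorem ncard_acyclic_dualActiveFixed :
    ({A : Finset α | A ⊆ M.E ∧ (M.reorient A).Acyclic ∧ M.DualActiveFixed A}.ncard : ℤ) =
      M.tutteEval 1 0 := by
  classical
  have fixed_iff : ∀ A, (M.reorient A).Acyclic ∧ M.DualActiveFixed A ↔
      (M.ActiveFixed A ∧ M.DualActiveFixed A) ∧ (M.reorient A).activity = 0 := fun A => by
    rw [← card_activeFinset, Finset.card_eq_zero, ← acyclic_iff]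
    exact ⟨fun h => ⟨⟨h.1.activeFixed, h.2⟩, h.1⟩, fun h => ⟨h.2, h.1.2⟩⟩
  simp only [natCast_ncard_subsets, tutteEval_eq_minorTutte, ← sum_fixed, one_pow, one_mul,
    zero_pow_eq, fixed_iff, ite_and]

theorem ncard_activeFixed_totallyCyclic :
    ({A : Finset α | A ⊆ M.E ∧ M.ActiveFixed A ∧ (M.reorient A).TotallyCyclic}.ncard : ℤ) =
      M.tutteEval 0 1 := by
  classical
  have fixed_iff : ∀ A, M.ActiveFixed A ∧ (M.reorient A).TotallyCyclic ↔
      (M.ActiveFixed A ∧ M.DualActiveFixed A) ∧ (M.reorient A).dualActivity = 0 := fun A => by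
    rw [← card_dualActiveFinset, Finset.card_eq_zero, ← totallyCyclic_iff]
    exact ⟨fun h => ⟨⟨h.1, h.2.dualActiveFixed⟩, h.2⟩, fun h => ⟨h.1.1, h.2⟩⟩
  simp only [natCast_ncard_subsets, tutteEval_eq_minorTutte, ← sum_fixed, one_pow, mul_one,
    zero_pow_eq, fixed_iff, ite_and]

theorem ncard_activeFixed :
    ({A : Finset α | A ⊆ M.E ∧ M.ActiveFixed A}.ncard : ℤ) = M.tutteEval 2 1 := by
  classical
  have h := M.sum_activityMonomial_ground (1 : ℤ) 1 1 0
  simpa only [activityMonomial, one_pow, one_mul, zero_pow_eq, Finset.card_eq_zero, add_zero,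
    one_add_one_eq_two, ← activeFixed_iff, ← natCast_ncard_subsets, ← tutteEval_eq_minorTutte]
    using h

theorem ncard_dualActiveFixed :
    ({A : Finset α | A ⊆ M.E ∧ M.DualActiveFixed A}.ncard : ℤ) = M.tutteEval 1 2 := by
  classical
  have h := M.sum_activityMonomial_ground (1 : ℤ) 0 1 1
  simpa only [activityMonomial, one_pow, one_mul, mul_one, zero_pow_eq, Finset.card_eq_zero,
    add_zero, one_add_one_eq_two, ← dualActiveFixed_iff, ← natCast_ncard_subsets,
    ← tutteEval_eq_minorTutte] using h

end Enumeration

/-! ### The active partition -/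

section PosUnionFlip

variable {E : Finset α} {V W : Set (α → SignType)} {L L₀ : Set α}
  [LinearOrder α] {S : Finset α}

theorem flip_eq_self {Y : α → SignType} (hY : ∀ x ∈ S, Y x = 0) : flip S Y = Y := by
  funext x
  by_cases hx : x ∈ S <;> simp [flip, hx, hY]

theorem flip_eq_neg {X : α → SignType} (hX : ∀ x ∉ S, X x = 0) : flip S X = -X := by
  funext x
  by_cases hx : x ∈ S <;> simp [flip, hx, hX]

theorem DualPair.flip_eq_self (hp : DualPair E V W) (hS : (S : Set α) = posUnion V L₀)
    {Y : α → SignType} (hY : Y ∈ W) (hYL : ∀ z ∉ L₀, 0 ≤ Y z) : flip S Y = Y :=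
  OrientedMatroid.flip_eq_self fun _ hx =>
    hp.eq_zero_of_mem_posUnion (hS ▸ Finset.mem_coe.2 hx) hY hYL

theorem DualPair.posUnion_subset_preimage_flip (hp : DualPair E V W)
    (hS : (S : Set α) = posUnion V L₀) (hL : L₀ ⊆ L) :
    posUnion V L ⊆ posUnion (flip S ⁻¹' V) L := by
  rintro x ⟨X, hX, hX0, hXL, hXx⟩
  have flip_eq : flip S X = -X := flip_eq_neg fun z hz => by_contra fun hXz => hz <| by
    rw [← Finset.mem_coe, hS]
    exact ⟨X, hX, hX0, fun w hw => hXL w (hL hw), hXz⟩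
  exact ⟨X, by rw [Set.mem_preimage, flip_eq]; exact hp.neg_left X hX, hX0, hXL, hXx⟩

theorem DualPair.posUnion_preimage_flip_subset (hp : DualPair E V W)
    (hp' : DualPair E (flip S ⁻¹' V) (flip S ⁻¹' W)) (hS : (S : Set α) = posUnion V L₀)
    (hL : L ⊆ L₀) : posUnion (flip S ⁻¹' V) L ⊆ posUnion V L := by
  intro x hx
  refine (hp.mem_posUnion_iff (hp'.posUnion_subset hx) (notMem_of_mem_posUnion hx)).2
    fun Y hY hYL => hp'.eq_zero_of_mem_posUnion hx ?_ hYL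
  rwa [Set.mem_preimage, hp.flip_eq_self hS hY fun z hz => hYL z (mt (@hL z) hz)]

theorem DualPair.posUnion_preimage_flip_self (hp : DualPair E V W)
    (hp' : DualPair E (flip S ⁻¹' V) (flip S ⁻¹' W)) (hS : (S : Set α) = posUnion V L₀) :
    posUnion (flip S ⁻¹' V) L₀ = posUnion V L₀ :=
  (hp.posUnion_preimage_flip_subset hp' hS subset_rfl).antisymm
    (hp.posUnion_subset_preimage_flip hS subset_rfl)

theorem DualPair.posUnion_preimage_flip_left (hp : DualPair E V W)
    (hp' : DualPair E (flip S ⁻¹' V) (flip S ⁻¹' W)) (hS : (S : Set α) = posUnion V L₀)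
    (hL : L ⊆ L₀ ∨ L₀ ⊆ L) : posUnion (flip S ⁻¹' V) L = posUnion V L := by
  have hS' := hS.trans (hp.posUnion_preimage_flip_self hp' hS).symm
  have hp'' : DualPair E (flip S ⁻¹' (flip S ⁻¹' V)) (flip S ⁻¹' (flip S ⁻¹' W)) := by
    rwa [preimage_flip_preimage_flip, preimage_flip_preimage_flip]
  rcases hL with hL | hL
  · refine (hp.posUnion_preimage_flip_subset hp' hS hL).antisymm ?_
    simpa only [preimage_flip_preimage_flip] using hp'.posUnion_preimage_flip_subset hp'' hS' hL
  · refine Set.Subset.antisymm ?_ (hp.posUnion_subset_preimage_flip hS hL)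
    simpa only [preimage_flip_preimage_flip] using hp'.posUnion_subset_preimage_flip hS' hL

theorem DualPair.posUnion_preimage_flip_right (hp : DualPair E V W)
    (hp' : DualPair E (flip S ⁻¹' V) (flip S ⁻¹' W)) (hS : (S : Set α) = posUnion V L₀) :
    posUnion (flip S ⁻¹' W) = posUnion W := by
  have hS' := hS.trans (hp.posUnion_preimage_flip_self hp' hS).symm
  refine funext fun L => Set.Subset.antisymm ?_ ?_ <;> rintro x ⟨Y, hY, hY0, hYL, hYx⟩
  · refine ⟨Y, ?_, hY0, hYL, hYx⟩
    rwa [Set.mem_preimage, hp'.flip_eq_self hS' hY fun z _ => hY0 z] at hY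
  · refine ⟨Y, ?_, hY0, hYL, hYx⟩
    rwa [Set.mem_preimage, hp.flip_eq_self hS hY fun z _ => hY0 z]

end PosUnionFlip

section ActiveFiltration

variable [LinearOrder α] {M N : OrientedMatroid α} {S T : Finset α} {a b x : α}

/-- The active filtration of `M`: for each lower set `L`, the union of the positive circuits and the
union of the positive cocircuits that avoid `L`. It determines the active partition. -/
def activeFiltration (M : OrientedMatroid α) (L : LowerSet α) : Set α × Set α :=
  (posUnion M.circuits L, posUnion M.cocircuits L)

theorem posUnion_circuits_congr (h : N.activeFiltration = M.activeFiltration) (L : LowerSet α) :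
    posUnion N.circuits L = posUnion M.circuits L :=
  congrArg Prod.fst (congrFun h L)

theorem posUnion_cocircuits_congr (h : N.activeFiltration = M.activeFiltration) (L : LowerSet α) :
    posUnion N.cocircuits L = posUnion M.cocircuits L :=
  congrArg Prod.snd (congrFun h L)

theorem activeFinset_congr (h : N.activeFiltration = M.activeFiltration) :
    N.activeFinset = M.activeFinset := by
  ext a
  rw [mem_activeFinset_iff, mem_activeFinset_iff, ← LowerSet.coe_Iio, posUnion_circuits_congr h]

theorem dualActiveFinset_congr (h : N.activeFiltration = M.activeFiltration) :
    N.dualActiveFinset = M.dualActiveFinset := by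
  ext a
  rw [mem_dualActiveFinset_iff, mem_dualActiveFinset_iff, ← LowerSet.coe_Iio,
    posUnion_cocircuits_congr h]

theorem dualPair_preimage_flip (M : OrientedMatroid α) (S : Finset α) :
    DualPair M.E (flip S ⁻¹' M.circuits) (flip S ⁻¹' M.cocircuits) :=
  M.circuits_reorient S ▸ M.cocircuits_reorient S ▸ (M.reorient S).dualPair

theorem activeFiltration_reorient_posUnion_circuits {L₀ : LowerSet α}
    (hS : (S : Set α) = posUnion M.circuits L₀) :
    (M.reorient S).activeFiltration = M.activeFiltration := by
  funext L
  rw [activeFiltration, circuits_reorient, cocircuits_reorient,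
    M.dualPair.posUnion_preimage_flip_left (M.dualPair_preimage_flip S) hS
      (L.lower.total L₀.lower),
    M.dualPair.posUnion_preimage_flip_right (M.dualPair_preimage_flip S) hS]
  rfl

theorem activeFiltration_reorient_posUnion_cocircuits {L₀ : LowerSet α}
    (hS : (S : Set α) = posUnion M.cocircuits L₀) :
    (M.reorient S).activeFiltration = M.activeFiltration := by
  funext L
  rw [activeFiltration, circuits_reorient, cocircuits_reorient,
    M.dualPair.symm.posUnion_preimage_flip_left (M.dualPair_preimage_flip S).symm hS
      (L.lower.total L₀.lower),
    M.dualPair.symm.posUnion_preimage_flip_right (M.dualPair_preimage_flip S).symm hS]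
  rfl

/-- Reorienting on `S` preserves the active filtration of every oriented matroid that has the same
active filtration as `M`. Quantifying over these makes the property stable under symmetric
difference. -/
def PreservesFiltration (M : OrientedMatroid α) (S : Finset α) : Prop :=
  ∀ N : OrientedMatroid α, N.activeFiltration = M.activeFiltration →
    (N.reorient S).activeFiltration = M.activeFiltration

theorem PreservesFiltration.symmDiff (hS : M.PreservesFiltration S)
    (hT : M.PreservesFiltration T) : M.PreservesFiltration (symmDiff S T) := fun N hN => by
  rw [← reorient_reorient]
  exact hT _ (hS N hN)

theorem exists_preservesFiltration_posUnion_circuits (M : OrientedMatroid α) (L : LowerSet α) :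
    ∃ S : Finset α, (S : Set α) = posUnion M.circuits L ∧ M.PreservesFiltration S := by
  obtain ⟨S, hS⟩ := (M.E.finite_toSet.subset M.dualPair.posUnion_subset).exists_finset_coe
  exact ⟨S, hS, fun N hN => (activeFiltration_reorient_posUnion_circuits
    (hS.trans (posUnion_circuits_congr hN L).symm)).trans hN⟩

theorem exists_preservesFiltration_posUnion_cocircuits (M : OrientedMatroid α) (L : LowerSet α) :
    ∃ S : Finset α, (S : Set α) = posUnion M.cocircuits L ∧ M.PreservesFiltration S := by
  obtain ⟨S, hS⟩ := (M.E.finite_toSet.subset M.dualPair.symm.posUnion_subset).exists_finset_coe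
  exact ⟨S, hS, fun N hN => (activeFiltration_reorient_posUnion_cocircuits
    (hS.trans (posUnion_cocircuits_congr hN L).symm)).trans hN⟩

theorem preservesFiltration_empty (M : OrientedMatroid α) : M.PreservesFiltration ∅ := by
  obtain ⟨S, -, hS⟩ := M.exists_preservesFiltration_posUnion_circuits ⊥
  simpa only [symmDiff_self, Finset.bot_eq_empty] using hS.symmDiff hS

end ActiveFiltration

section ActivePartition

variable [LinearOrder α] {M N : OrientedMatroid α} {V : Set (α → SignType)} {E T : Finset α}
  {a b x : α}

theorem sUnion_eq_posUnion (hV : ∀ X ∈ V, support X ⊆ E) {L : LowerSet α} {p : α → Prop}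
    (hp : ∀ m, p m ↔ m ∉ L) :
    ⋃₀ {C | (∃ X ∈ V, (∀ e, 0 ≤ X e) ∧ support X = C) ∧ ∃ m, IsLeast C m ∧ p m} =
      posUnion V L := by
  ext x
  constructor
  · rintro ⟨_, ⟨⟨X, hX, hX0, rfl⟩, m, hm, hpm⟩, hx⟩
    exact ⟨X, hX, hX0, fun z hz => by_contra fun hXz => (hp m).1 hpm (L.lower (hm.2 hXz) hz), hx⟩
  · rintro ⟨X, hX, hX0, hXL, hXx⟩
    obtain ⟨m, hm⟩ := exists_isLeast_support (hV X hX) ⟨x, hXx⟩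
    exact ⟨_, ⟨⟨X, hX, hX0, rfl⟩, m, hm, (hp m).2 fun hmL => hm.1 (hXL m hmL)⟩, hXx⟩

theorem cyclicPart_eq (M : OrientedMatroid α) (a : α) :
    M.cyclicPart a = posUnion M.circuits (Set.Iio a) \ posUnion M.circuits (Set.Iic a) :=
  congrArg₂ (· \ ·)
    (sUnion_eq_posUnion (L := LowerSet.Iio a) M.support_subset fun m => by simp)
    (sUnion_eq_posUnion (L := LowerSet.Iic a) M.support_subset fun m => by simp)

theorem acyclicPart_eq (M : OrientedMatroid α) (a : α) :
    M.acyclicPart a = posUnion M.cocircuits (Set.Iio a) \ posUnion M.cocircuits (Set.Iic a) :=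
  congrArg₂ (· \ ·)
    (sUnion_eq_posUnion (L := LowerSet.Iio a) M.dualPair.support_right fun m => by simp)
    (sUnion_eq_posUnion (L := LowerSet.Iic a) M.dualPair.support_right fun m => by simp)

theorem posUnion_Iio_sdiff_Iic_eq_empty (ha : a ∉ posUnion V (Set.Iio a)) :
    posUnion V (Set.Iio a) \ posUnion V (Set.Iic a) = ∅ := by
  rw [Set.sdiff_eq_empty]
  rintro x ⟨X, hX, hX0, hXL, hXx⟩
  refine ⟨X, hX, hX0, fun z hz => ?_, hXx⟩
  rcases (Set.mem_Iic.1 hz).lt_or_eq with hz | rfl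
  exacts [hXL z hz, by_contra fun hXz => ha ⟨X, hX, hX0, hXL, hXz⟩]

theorem mem_posUnion_Iio_sdiff_Iic_unique (ha : x ∈ posUnion V (Set.Iio a) \ posUnion V (Set.Iic a))
    (hb : x ∈ posUnion V (Set.Iio b) \ posUnion V (Set.Iic b)) : a = b := by
  by_contra hab
  rcases lt_or_gt_of_ne hab with h | h
  · exact ha.2 (posUnion_anti V (Set.Iic_subset_Iio.2 h) hb.1)
  · exact hb.2 (posUnion_anti V (Set.Iic_subset_Iio.2 h) ha.1)

open Classical in
/-- The part of the active partition with minimum `a`, for `a` active or dual-active; otherwise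
it is empty. -/
noncomputable def part (M : OrientedMatroid α) (a : α) : Finset α :=
  {x ∈ M.E | x ∈ M.cyclicPart a ∪ M.acyclicPart a}

/-- The minima of the parts of the active partition: the active and the dual-active elements. -/
noncomputable def partMinima (M : OrientedMatroid α) : Finset α :=
  M.activeFinset ∪ M.dualActiveFinset

/-- The union of the parts of the active partition with minimum in `T`. -/
noncomputable def partUnion (M : OrientedMatroid α) (T : Finset α) : Finset α :=
  T.biUnion M.part

theorem coe_part (M : OrientedMatroid α) (a : α) :
    (M.part a : Set α) = M.cyclicPart a ∪ M.acyclicPart a := by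
  have hsub : M.cyclicPart a ∪ M.acyclicPart a ⊆ M.E := by
    rw [cyclicPart_eq, acyclicPart_eq]
    exact Set.union_subset (Set.sdiff_subset.trans M.dualPair.posUnion_subset)
      (Set.sdiff_subset.trans M.dualPair.symm.posUnion_subset)
  ext x
  simpa [part] using @hsub x

theorem part_congr (h : N.activeFiltration = M.activeFiltration) : N.part = M.part := by
  funext a
  rw [← Finset.coe_inj, coe_part, coe_part]
  simp only [cyclicPart_eq, acyclicPart_eq, ← LowerSet.coe_Iio, ← LowerSet.coe_Iic,
    posUnion_circuits_congr h, posUnion_cocircuits_congr h]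

theorem partUnion_congr (h : N.activeFiltration = M.activeFiltration) (T : Finset α) :
    N.partUnion T = M.partUnion T := by
  rw [partUnion, part_congr h, partUnion]

theorem partMinima_congr (h : N.activeFiltration = M.activeFiltration) :
    N.partMinima = M.partMinima := by
  rw [partMinima, activeFinset_congr h, dualActiveFinset_congr h, partMinima]

open Classical in
theorem partUnion_subset (M : OrientedMatroid α) (T : Finset α) : M.partUnion T ⊆ M.E :=
  Finset.biUnion_subset.2 fun _ _ => Finset.filter_subset _ _

theorem disjoint_cyclicPart_acyclicPart (M : OrientedMatroid α) (a b : α) :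
    Disjoint (M.cyclicPart a) (M.acyclicPart b) := by
  rw [cyclicPart_eq, acyclicPart_eq]
  exact (M.dualPair.disjoint_posUnion _ _).mono Set.sdiff_subset Set.sdiff_subset

theorem eq_of_mem_part (ha : x ∈ M.part a) (hb : x ∈ M.part b) : a = b := by
  rw [← Finset.mem_coe, coe_part] at ha hb
  rcases ha with ha | ha <;> rcases hb with hb | hb
  · rw [cyclicPart_eq] at ha hb
    exact mem_posUnion_Iio_sdiff_Iic_unique ha hb
  · exact absurd hb (Set.disjoint_left.1 (M.disjoint_cyclicPart_acyclicPart a b) ha)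
  · exact absurd ha (Set.disjoint_left.1 (M.disjoint_cyclicPart_acyclicPart b a) hb)
  · rw [acyclicPart_eq] at ha hb
    exact mem_posUnion_Iio_sdiff_Iic_unique ha hb

theorem disjoint_part (hab : a ≠ b) : Disjoint (M.part a) (M.part b) :=
  Finset.disjoint_left.2 fun _ ha hb => hab (eq_of_mem_part ha hb)

theorem mem_part_self_iff : a ∈ M.part a ↔ a ∈ M.partMinima := by
  have notMem : ∀ V, a ∉ posUnion V (Set.Iic a) := fun V h =>
    notMem_of_mem_posUnion h (Set.mem_Iic.2 le_rfl)
  rw [← Finset.mem_coe, coe_part, cyclicPart_eq, acyclicPart_eq, partMinima, Finset.mem_union,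
    mem_activeFinset_iff, mem_dualActiveFinset_iff, Set.mem_union, Set.mem_sdiff, Set.mem_sdiff,
    and_iff_left (notMem _), and_iff_left (notMem _)]

theorem partUnion_inter_partMinima (hT : T ⊆ M.partMinima) :
    M.partUnion T ∩ M.partMinima = T := by
  ext a
  rw [Finset.mem_inter, partUnion, Finset.mem_biUnion]
  constructor
  · rintro ⟨⟨b, hb, hab⟩, ha⟩
    rwa [eq_of_mem_part (mem_part_self_iff.2 ha) hab]
  · exact fun ha => ⟨⟨a, ha, mem_part_self_iff.2 (hT ha)⟩, hT ha⟩

theorem coe_part_of_mem_activeFinset (ha : a ∈ M.activeFinset) : M.part a = M.cyclicPart a := by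
  have hempty : M.acyclicPart a = ∅ := (M.acyclicPart_eq a).trans <|
    posUnion_Iio_sdiff_Iic_eq_empty fun h =>
      Finset.disjoint_left.1 M.disjoint_activeFinset_dualActiveFinset ha
        (mem_dualActiveFinset_iff.2 h)
  rw [coe_part, hempty, Set.union_empty]

theorem coe_part_of_mem_dualActiveFinset (ha : a ∈ M.dualActiveFinset) :
    M.part a = M.acyclicPart a := by
  have hempty : M.cyclicPart a = ∅ := (M.cyclicPart_eq a).trans <|
    posUnion_Iio_sdiff_Iic_eq_empty fun h =>
      Finset.disjoint_left.1 M.disjoint_activeFinset_dualActiveFinset (mem_activeFinset_iff.2 h) ha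
  rw [coe_part, hempty, Set.empty_union]

theorem activePartition_eq (M : OrientedMatroid α) :
    M.activePartition = (fun a => (M.part a : Set α)) '' M.partMinima := by
  rw [partMinima, Finset.coe_union, Set.image_union, activePartition, ← coe_activeFinset,
    ← coe_dualActiveFinset]
  exact congrArg₂ (· ∪ ·) (Set.image_congr fun a ha => (coe_part_of_mem_activeFinset ha).symm)
    (Set.image_congr fun a ha => (coe_part_of_mem_dualActiveFinset ha).symm)

theorem preservesFiltration_part (M : OrientedMatroid α) (a : α) :
    M.PreservesFiltration (M.part a) := by
  obtain ⟨S, hS, hS'⟩ := M.exists_preservesFiltration_posUnion_circuits (LowerSet.Iio a)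
  obtain ⟨S₁, hS₁, hS₁'⟩ := M.exists_preservesFiltration_posUnion_circuits (LowerSet.Iic a)
  obtain ⟨T, hT, hT'⟩ := M.exists_preservesFiltration_posUnion_cocircuits (LowerSet.Iio a)
  obtain ⟨T₁, hT₁, hT₁'⟩ := M.exists_preservesFiltration_posUnion_cocircuits (LowerSet.Iic a)
  have part_eq : M.part a = symmDiff (symmDiff S S₁) (symmDiff T T₁) := by
    rw [LowerSet.coe_Iio] at hS hT
    rw [LowerSet.coe_Iic] at hS₁ hT₁
    have disjoint := M.disjoint_cyclicPart_acyclicPart a a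
    rw [← Finset.coe_inj, coe_part, Finset.coe_symmDiff, Finset.coe_symmDiff, Finset.coe_symmDiff,
      hS, hS₁, hT, hT₁, symmDiff_of_ge (posUnion_anti _ Set.Iio_subset_Iic_self),
      symmDiff_of_ge (posUnion_anti _ Set.Iio_subset_Iic_self), ← cyclicPart_eq, ← acyclicPart_eq,
      disjoint.symmDiff_eq_sup]
    rfl
  rw [part_eq]
  exact (hS'.symmDiff hS₁').symmDiff (hT'.symmDiff hT₁')

theorem preservesFiltration_partUnion (M : OrientedMatroid α) (T : Finset α) :
    M.PreservesFiltration (M.partUnion T) := by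
  induction T using Finset.induction_on with
  | empty => exact M.preservesFiltration_empty
  | insert a T ha ih =>
    have disjoint : Disjoint (M.part a) (M.partUnion T) :=
      (Finset.disjoint_biUnion_right _ _ _).2 fun b hb =>
        disjoint_part (ne_of_mem_of_not_mem hb ha).symm
    rw [partUnion, Finset.biUnion_insert, ← Finset.sup_eq_union, ← partUnion,
      ← disjoint.symmDiff_eq_sup]
    exact (M.preservesFiltration_part a).symmDiff ih

theorem partUnion_symmDiff (M : OrientedMatroid α) (T T' : Finset α) :
    M.partUnion (symmDiff T T') = symmDiff (M.partUnion T) (M.partUnion T') := by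
  have hmem : ∀ {a x}, x ∈ M.part a → ∀ U, x ∈ M.partUnion U ↔ a ∈ U := fun {a x} hx U => by
    rw [partUnion, Finset.mem_biUnion]
    exact ⟨fun ⟨b, hb, hxb⟩ => eq_of_mem_part hx hxb ▸ hb, fun ha => ⟨a, ha, hx⟩⟩
  ext x
  by_cases hx : ∃ a, x ∈ M.part a
  · obtain ⟨a, hxa⟩ := hx
    simp only [Finset.mem_symmDiff, hmem hxa]
  · push Not at hx
    simp [partUnion, Finset.mem_symmDiff, hx]

end ActivePartition

/-! ### Activity classes -/

section ActivityClass

variable [LinearOrder α] {M : OrientedMatroid α} {A B : Finset α}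

theorem mem_activityClass_iff : B ∈ M.activityClass A ↔
    ∃ T ⊆ (M.reorient A).partMinima, B = symmDiff A ((M.reorient A).partUnion T) := by
  have coe_partUnion : ∀ T, ((M.reorient A).partUnion T : Set α) =
      ⋃₀ ((fun a => ((M.reorient A).part a : Set α)) '' T) := fun T => by
    simp [partUnion, Set.sUnion_image]
  simp only [activityClass, activePartition_eq, Set.mem_ofPred_eq]
  constructor
  · rintro ⟨P, hP, hB⟩
    obtain ⟨T, hT, rfl⟩ := Set.subset_image_iff.1 hP
    lift T to Finset α using (Finset.finite_toSet _).subset hT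
    exact ⟨T, Finset.coe_subset.1 hT, by rw [← Finset.coe_inj, hB, ← coe_partUnion,
      Finset.coe_symmDiff]⟩
  · rintro ⟨T, hT, rfl⟩
    exact ⟨_, Set.image_mono (Finset.coe_subset.2 hT), by rw [← coe_partUnion,
      Finset.coe_symmDiff]⟩

theorem self_mem_activityClass (M : OrientedMatroid α) (A : Finset α) :
    A ∈ M.activityClass A :=
  mem_activityClass_iff.2 ⟨∅, Finset.empty_subset _, by
    rw [partUnion, Finset.biUnion_empty, ← Finset.bot_eq_empty, symmDiff_bot]⟩

theorem subset_of_mem_activityClass (hA : A ⊆ M.E) (hB : B ∈ M.activityClass A) : B ⊆ M.E := by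
  obtain ⟨T, -, rfl⟩ := mem_activityClass_iff.1 hB
  exact symmDiff_le_sup.trans (sup_le hA ((M.reorient A).partUnion_subset T))

theorem activeFiltration_of_mem_activityClass (hB : B ∈ M.activityClass A) :
    (M.reorient B).activeFiltration = (M.reorient A).activeFiltration := by
  obtain ⟨T, -, rfl⟩ := mem_activityClass_iff.1 hB
  rw [← reorient_reorient]
  exact preservesFiltration_partUnion _ T _ rfl

theorem activityClass_subset_of_mem (hB : B ∈ M.activityClass A) :
    M.activityClass B ⊆ M.activityClass A := by
  have hfilt := activeFiltration_of_mem_activityClass hB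
  obtain ⟨T, hT, rfl⟩ := mem_activityClass_iff.1 hB
  intro C hC
  obtain ⟨T', hT', rfl⟩ := mem_activityClass_iff.1 hC
  rw [partMinima_congr hfilt] at hT'
  refine mem_activityClass_iff.2 ⟨symmDiff T T', symmDiff_le_sup.trans (sup_le hT hT'), ?_⟩
  rw [partUnion_congr hfilt, partUnion_symmDiff, symmDiff_assoc]

theorem mem_activityClass_symm (hB : B ∈ M.activityClass A) : A ∈ M.activityClass B := by
  have hfilt := activeFiltration_of_mem_activityClass hB
  obtain ⟨T, hT, rfl⟩ := mem_activityClass_iff.1 hB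
  refine mem_activityClass_iff.2 ⟨T, (partMinima_congr hfilt).symm ▸ hT, ?_⟩
  rw [partUnion_congr hfilt, symmDiff_symmDiff_cancel_right]

theorem activityClass_eq_of_mem (hB : B ∈ M.activityClass A) :
    M.activityClass B = M.activityClass A :=
  (activityClass_subset_of_mem hB).antisymm
    (activityClass_subset_of_mem (mem_activityClass_symm hB))

theorem bijOn_inter_partMinima (M : OrientedMatroid α) (A : Finset α) :
    Set.BijOn (· ∩ (M.reorient A).partMinima) (M.activityClass A)
      ((M.reorient A).partMinima.powerset : Set (Finset α)) := by
  set N := M.reorient A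
  have inter_eq : ∀ T ⊆ N.partMinima, symmDiff A (N.partUnion T) ∩ N.partMinima =
      symmDiff (A ∩ N.partMinima) T := fun T hT => by
    rw [← Finset.inf_eq_inter, inf_symmDiff_distrib_right, Finset.inf_eq_inter,
      Finset.inf_eq_inter, partUnion_inter_partMinima hT]
  refine ⟨fun B _ => ?_, fun B hB B' hB' h => ?_, fun U hU => ?_⟩
  · exact Finset.mem_coe.2 (Finset.mem_powerset.2 Finset.inter_subset_right)
  · obtain ⟨T, hT, rfl⟩ := mem_activityClass_iff.1 hB
    obtain ⟨T', hT', rfl⟩ := mem_activityClass_iff.1 hB'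
    rw [symmDiff_right_injective _ ((inter_eq T hT).symm.trans (h.trans (inter_eq T' hT')))]
  · have hT : symmDiff (A ∩ N.partMinima) U ⊆ N.partMinima :=
      symmDiff_le_sup.trans (sup_le Finset.inter_subset_right (Finset.mem_powerset.1 hU))
    exact ⟨_, mem_activityClass_iff.2 ⟨_, hT, rfl⟩,
      (inter_eq _ hT).trans (symmDiff_symmDiff_cancel_left _ _)⟩

theorem inter_eq_empty_iff_inter_union_subset {O P : Finset α} (h : Disjoint O P) :
    O ∩ B = ∅ ↔ B ∩ (O ∪ P) ⊆ P := by
  rw [Finset.inter_union_distrib_left, Finset.union_subset_iff,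
    and_iff_left Finset.inter_subset_right, Finset.inter_comm B]
  refine ⟨fun h' => h' ▸ Finset.empty_subset P, fun h' => Finset.subset_empty.1 ?_⟩
  exact (Finset.subset_inter Finset.inter_subset_left h').trans
    (Finset.disjoint_iff_inter_eq_empty.1 h).subset

theorem activeFixed_iff_of_mem (hB : B ∈ M.activityClass A) : M.ActiveFixed B ↔
    B ∩ (M.reorient A).partMinima ⊆ (M.reorient A).dualActiveFinset := by
  rw [activeFixed_iff, activeFinset_congr (activeFiltration_of_mem_activityClass hB),
    inter_eq_empty_iff_inter_union_subset
      (M.reorient A).disjoint_activeFinset_dualActiveFinset, partMinima]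

theorem dualActiveFixed_iff_of_mem (hB : B ∈ M.activityClass A) : M.DualActiveFixed B ↔
    B ∩ (M.reorient A).partMinima ⊆ (M.reorient A).activeFinset := by
  rw [dualActiveFixed_iff, dualActiveFinset_congr (activeFiltration_of_mem_activityClass hB),
    inter_eq_empty_iff_inter_union_subset
      (M.reorient A).disjoint_activeFinset_dualActiveFinset.symm, partMinima,
    Finset.union_comm]

theorem ncard_activityClass_inter_subset {Q : Finset α} (hQ : Q ⊆ (M.reorient A).partMinima) :
    {B ∈ M.activityClass A | B ∩ (M.reorient A).partMinima ⊆ Q}.ncard = 2 ^ Q.card := by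
  have hbij := M.bijOn_inter_partMinima A
  have himage : (· ∩ (M.reorient A).partMinima) ''
      {B ∈ M.activityClass A | B ∩ (M.reorient A).partMinima ⊆ Q} = Q.powerset := by
    ext U
    rw [Finset.mem_coe, Finset.mem_powerset]
    constructor
    · rintro ⟨B, hB, rfl⟩
      exact hB.2
    · intro hU
      obtain ⟨B, hB, rfl⟩ := hbij.surjOn (Finset.mem_coe.2 (Finset.mem_powerset.2 (hU.trans hQ)))
      exact ⟨B, ⟨hB, hU⟩, rfl⟩
  rw [← (hbij.injOn.mono (Set.sep_subset _ _)).ncard_image, himage,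
    Set.ncard_coe_finset, Finset.card_powerset]

theorem ncard_activeFixed_activityClass (M : OrientedMatroid α) (A : Finset α) :
    {B ∈ M.activityClass A | M.ActiveFixed B}.ncard = 2 ^ (M.reorient A).dualActivity := by
  rw [← card_dualActiveFinset, ← ncard_activityClass_inter_subset Finset.subset_union_right]
  exact congrArg Set.ncard (Set.sep_ext_iff.2 fun B hB => activeFixed_iff_of_mem hB)

theorem ncard_dualActiveFixed_activityClass (M : OrientedMatroid α) (A : Finset α) :
    {B ∈ M.activityClass A | M.DualActiveFixed B}.ncard = 2 ^ (M.reorient A).activity := by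
  rw [← card_activeFinset, ← ncard_activityClass_inter_subset Finset.subset_union_left]
  exact congrArg Set.ncard (Set.sep_ext_iff.2 fun B hB => dualActiveFixed_iff_of_mem hB)

theorem fixed_iff_of_mem (hB : B ∈ M.activityClass A) :
    M.ActiveFixed B ∧ M.DualActiveFixed B ↔ B ∩ (M.reorient A).partMinima = ∅ := by
  rw [activeFixed_iff_of_mem hB, dualActiveFixed_iff_of_mem hB, and_comm, ← Finset.subset_inter_iff,
    Finset.disjoint_iff_inter_eq_empty.1 (M.reorient A).disjoint_activeFinset_dualActiveFinset,
    Finset.subset_empty]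

theorem existsUnique_fixed {K : Set (Finset α)} (hK : K ∈ M.activityClasses) :
    ∃! A, A ∈ K ∧ M.ActiveFixed A ∧ M.DualActiveFixed A := by
  obtain ⟨A, -, rfl⟩ := hK
  have hbij := M.bijOn_inter_partMinima A
  obtain ⟨B, hB, hBA⟩ := hbij.surjOn (Finset.mem_coe.2 (Finset.empty_mem_powerset _))
  refine ⟨B, ⟨hB, (fixed_iff_of_mem hB).2 hBA⟩, fun C hC => hbij.injOn hC.1 hB ?_⟩
  exact ((fixed_iff_of_mem hC.1).1 hC.2).trans hBA.symm

theorem existsUnique_dualActiveFixed {K : Set (Finset α)} (hK : K ∈ M.activityClasses)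
    (hac : ∀ A ∈ K, (M.reorient A).Acyclic) : ∃! A, A ∈ K ∧ M.DualActiveFixed A := by
  obtain ⟨A, ⟨hA, -, hfix⟩, huniq⟩ := existsUnique_fixed hK
  exact ⟨A, ⟨hA, hfix⟩, fun B hB => huniq B ⟨hB.1, (hac B hB.1).activeFixed, hB.2⟩⟩

theorem existsUnique_activeFixed {K : Set (Finset α)} (hK : K ∈ M.activityClasses)
    (htc : ∀ A ∈ K, (M.reorient A).TotallyCyclic) : ∃! A, A ∈ K ∧ M.ActiveFixed A := by
  obtain ⟨A, ⟨hA, hfix, -⟩, huniq⟩ := existsUnique_fixed hK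
  exact ⟨A, ⟨hA, hfix⟩, fun B hB => huniq B ⟨hB.1, hB.2, (htc B hB.1).dualActiveFixed⟩⟩

theorem ncard_activityClasses_forall {p : OrientedMatroid α → Prop}
    (hp : ∀ {N N' : OrientedMatroid α}, N.activeFiltration = N'.activeFiltration → p N' → p N) :
    {K ∈ M.activityClasses | ∀ A ∈ K, p (M.reorient A)}.ncard =
      {A | A ⊆ M.E ∧ M.ActiveFixed A ∧ M.DualActiveFixed A ∧ p (M.reorient A)}.ncard := by
  have himage : M.activityClass ''
      {A | A ⊆ M.E ∧ M.ActiveFixed A ∧ M.DualActiveFixed A ∧ p (M.reorient A)} =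
      {K ∈ M.activityClasses | ∀ A ∈ K, p (M.reorient A)} := by
    ext K
    constructor
    · rintro ⟨A, ⟨hA, -, -, hpA⟩, rfl⟩
      exact ⟨⟨A, hA, rfl⟩, fun B hB => hp (activeFiltration_of_mem_activityClass hB) hpA⟩
    · rintro ⟨hK, hpK⟩
      obtain ⟨B, ⟨hB, hfix⟩, -⟩ := existsUnique_fixed hK
      obtain ⟨A, hA, rfl⟩ := hK
      exact ⟨B, ⟨subset_of_mem_activityClass hA hB, hfix.1, hfix.2, hpK B hB⟩,
        activityClass_eq_of_mem hB⟩
  rw [← himage, Set.InjOn.ncard_image]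
  rintro A ⟨hA, hfix, hfix', -⟩ B ⟨-, hfixB, hfixB', -⟩ (hAB : M.activityClass A = _)
  exact (existsUnique_fixed ⟨A, hA, rfl⟩).unique ⟨M.self_mem_activityClass A, hfix, hfix'⟩
    ⟨hAB ▸ M.self_mem_activityClass B, hfixB, hfixB'⟩

theorem ncard_activityClasses_hasActivities (M : OrientedMatroid α) (i j : ℕ) :
    ({K ∈ M.activityClasses | M.ClassHasActivities K i j}.ncard : ℤ) = M.tutteCoeff j i := by
  rw [← ncard_fixed_activities]
  refine congrArg _ (ncard_activityClasses_forall
    (p := fun N => N.activity = i ∧ N.dualActivity = j) fun {N N'} h hN => ?_)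
  rwa [← card_activeFinset, ← card_dualActiveFinset, activeFinset_congr h,
    dualActiveFinset_congr h, card_activeFinset, card_dualActiveFinset]

theorem ncard_activityClasses (M : OrientedMatroid α) :
    (M.activityClasses.ncard : ℤ) = M.tutteEval 1 1 := by
  rw [← ncard_fixed]
  simpa using congrArg (Nat.cast : ℕ → ℤ)
    (ncard_activityClasses_forall (M := M) (p := fun _ => True) fun _ h => h)

theorem ncard_acyclic_activityClasses (M : OrientedMatroid α) :
    ({K ∈ M.activityClasses | ∀ A ∈ K, (M.reorient A).Acyclic}.ncard : ℤ) =
      M.tutteEval 1 0 := by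
  rw [← ncard_acyclic_dualActiveFixed, ncard_activityClasses_forall fun h h' => ?_]
  · congr! 5 with A
    exact ⟨fun h => ⟨h.2.2, h.2.1⟩, fun h => ⟨h.1.activeFixed, h.2, h.1⟩⟩
  · rwa [acyclic_iff, activeFinset_congr h, ← acyclic_iff]

theorem ncard_totallyCyclic_activityClasses (M : OrientedMatroid α) :
    ({K ∈ M.activityClasses | ∀ A ∈ K, (M.reorient A).TotallyCyclic}.ncard : ℤ) =
      M.tutteEval 0 1 := by
  rw [← ncard_activeFixed_totallyCyclic, ncard_activityClasses_forall fun h h' => ?_]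
  · congr! 5 with A
    exact ⟨fun h => ⟨h.1, h.2.2⟩, fun h => ⟨h.1, h.2.dualActiveFixed, h.2⟩⟩
  · rwa [totallyCyclic_iff, dualActiveFinset_congr h, ← totallyCyclic_iff]

theorem ncard_fixed_of_classHasActivities {K : Set (Finset α)} {i j : ℕ}
    (hK : K ∈ M.activityClasses) (h : M.ClassHasActivities K i j) :
    {A ∈ K | M.ActiveFixed A}.ncard = 2 ^ j ∧ {A ∈ K | M.DualActiveFixed A}.ncard = 2 ^ i := by
  obtain ⟨A, -, rfl⟩ := hK
  obtain ⟨rfl, rfl⟩ := h A (M.self_mem_activityClass A)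
  exact ⟨M.ncard_activeFixed_activityClass A, M.ncard_dualActiveFixed_activityClass A⟩

end ActivityClass

end OrientedMatroid

theorem corollary4p10 {α : Type*} [LinearOrder α] (M : OrientedMatroid α) :
    -- the number of activity classes with activity `i` and dual activity `j`
    (∀ i j : ℕ, ({K ∈ M.activityClasses | M.ClassHasActivities K i j}.ncard : ℤ)
      = M.tutteCoeff j i) ∧
    -- the canonical representative of each class, and the number of such representatives
    (∀ K ∈ M.activityClasses, ∃! A, A ∈ K ∧ M.ActiveFixed A ∧ M.DualActiveFixed A) ∧
    (∀ i j : ℕ, ({A : Finset α | A ⊆ M.E ∧ M.ActiveFixed A ∧ M.DualActiveFixed A ∧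
      (M.reorient A).activity = i ∧ (M.reorient A).dualActivity = j}.ncard : ℤ)
      = M.tutteCoeff j i) ∧
    -- active-fixed and dual-active-fixed reorientations in a class
    (∀ i j : ℕ, ∀ K ∈ M.activityClasses, M.ClassHasActivities K i j →
      {A ∈ K | M.ActiveFixed A}.ncard = 2 ^ j ∧ {A ∈ K | M.DualActiveFixed A}.ncard = 2 ^ i) ∧
    -- `t(M;1,1)`
    (({A : Finset α | A ⊆ M.E ∧ M.ActiveFixed A ∧ M.DualActiveFixed A}.ncard : ℤ)
        = M.tutteEval 1 1 ∧
      (M.activityClasses.ncard : ℤ) = M.tutteEval 1 1) ∧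
    -- `t(M;1,0)`
    (({A : Finset α | A ⊆ M.E ∧ (M.reorient A).Acyclic ∧ M.DualActiveFixed A}.ncard : ℤ)
        = M.tutteEval 1 0 ∧
      ({K ∈ M.activityClasses | ∀ A ∈ K, (M.reorient A).Acyclic}.ncard : ℤ)
        = M.tutteEval 1 0 ∧
      (∀ K ∈ M.activityClasses, (∀ A ∈ K, (M.reorient A).Acyclic) →
        ∃! A, A ∈ K ∧ M.DualActiveFixed A)) ∧
    -- `t(M;0,1)`
    (({A : Finset α | A ⊆ M.E ∧ M.ActiveFixed A ∧ (M.reorient A).TotallyCyclic}.ncard : ℤ)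
        = M.tutteEval 0 1 ∧
      ({K ∈ M.activityClasses | ∀ A ∈ K, (M.reorient A).TotallyCyclic}.ncard : ℤ)
        = M.tutteEval 0 1 ∧
      (∀ K ∈ M.activityClasses, (∀ A ∈ K, (M.reorient A).TotallyCyclic) →
        ∃! A, A ∈ K ∧ M.ActiveFixed A)) ∧
    -- `t(M;2,1)` and `t(M;1,2)`
    ({A : Finset α | A ⊆ M.E ∧ M.ActiveFixed A}.ncard : ℤ) = M.tutteEval 2 1 ∧
    ({A : Finset α | A ⊆ M.E ∧ M.DualActiveFixed A}.ncard : ℤ) = M.tutteEval 1 2 := by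
  exact ⟨M.ncard_activityClasses_hasActivities, fun _ hK => OrientedMatroid.existsUnique_fixed hK,
    M.ncard_fixed_activities,
    fun _ _ _ hK h => OrientedMatroid.ncard_fixed_of_classHasActivities hK h,
    ⟨M.ncard_fixed, M.ncard_activityClasses⟩,
    ⟨M.ncard_acyclic_dualActiveFixed, M.ncard_acyclic_activityClasses,
      fun _ hK => OrientedMatroid.existsUnique_dualActiveFixed hK⟩,
    ⟨M.ncard_activeFixed_totallyCyclic, M.ncard_totallyCyclic_activityClasses,
      fun _ hK => OrientedMatroid.existsUnique_activeFixed hK⟩,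
    M.ncard_activeFixed, M.ncard_dualActiveFixed⟩
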